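/- **Setting.** An MDP without reward consists of a finite state set $\mathcal S$, an action set $\mathcal A$, transition probabilities, a discount factor $\gamma\in[0,1)$, an initial distribution, and a feature map $\phi:\mathcal S\to[0,1]^k$, $k\ge 1$. For a policy $\pi$ let $\Psi(\pi)=\mathbb E[\sum_{t\ge0}\gamma^t\phi(s_t)]\in\mathbb R^k$, so that the expected reward of $\pi$ under weights $w\in\mathbb R^k$ is $w\cdot\Psi(\pi)$, and let $P_F=\{\Psi(\pi)\}$. Feature vectors are normalized so that $\|\mu\|_1\le k$ for all $\mu\in P_F$. Given an expert policy $\pi_E$ with $\mu_E=\Psi(\pi_E)$ and $\epsilon>0$, let $$P_R=\{w\in[-1,1]^k : w\cdot\mu_E\ge w\cdot\mu-\epsilon\ \ \forall\mu\in P_F\}.$$ The MDP is accessed only through an approximate solver $\widehat{\mathrm{ALG}}$: for every $w\in\mathbb R^k$ and $\eta>0$, $\widehat{\mathrm{ALG}}(w,\eta)$ returns a policy $\pi$ and $\mu=\Psi(\pi)$ with $w\cdot\mu\ge\max_{\mu'\in P_F}w\cdot\mu'-\eta$ (and $w\mapsto\mu$ is measurable). The *weird separation oracle* $WSO_R^\eta$,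 on input $w'$, computes $\mu$, the feature vector returned by $\widehat{\mathrm{ALG}}(w',\eta)$; if $\mu\cdot w'>\mu_E\cdot w'+\epsilon$ it answers NO with the hyperplane $(\mu_E-\mu)\cdot w+\epsilon\ge0$, and otherwise it answers YES. **Algorithm.** Let $T\ge1$, $c>0$, $\delta=\frac1{k\sqrt T}$, $\eta_1=\frac c{2T}$, $\eta_2=\frac{c\epsilon}{2k^2T-c}$. Let $p_1,\dots,p_T,q_1,\dots,q_T$ be independent and uniform on $[0,1/\delta]^k$. In round $t=1,\dots,T$: 1. let $(\pi_t,\mu_t)$ be the output of $\widehat{\mathrm{ALG}}\big(\tfrac1T(\sum_{i<t}w_i+p_t),\eta_1\big)$; 2. run the following linear optimization routine for $\min_w w\cdot s$ with $s=\sum_{i<t}\mu_i+q_t$: perform $J$ steps of binary search for the objective value, starting from the interval $[-\|s\|_1,0]$ and the incumbent $w=0$; for each threshold $\alpha$, run $N$ iterations of the central-cut ellipsoid method from the ball of radius $\sqrt k$ about $0$, cutting with the box $[-1,1]^k$ or with $s\cdot w\le\alpha$ when the current center violates one of them, and otherwise querying $WSO_R^{\eta_2}$ at the center; an accepted center becomes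 the incumbent and lowers the upper end of the interval to $\alpha$, and if none is accepted, the lower end is raised to $\alpha$. Let $w'_t$ be the final incumbent and set $w_t=\frac{\epsilon}{\epsilon+\eta_2}\,w'_t$. The output is the randomized policy $\pi=\frac1T\sum_{t=1}^T\pi_t$, whose expected reward under $w$ is $\frac1T\sum_t\Psi(\pi_t)\cdot w$. **Theorem.** There are absolute constants $C,d\in\mathbb N$ and a choice of the iteration numbers $N,J$ as functions of $(k,T,\epsilon,c)$ only, such that for all $k,T\ge1$ and $\epsilon,c>0$, $$N\cdot J\le B:=C\Big(k\big(1+\ln T+\ln(1+\tfrac1\epsilon)+\ln(1+\tfrac1c)\big)\Big)^d,$$ and for every MDP, expert policy and approximate solver as above: * in every round the algorithm makes exactly one direct query to $\widehat{\mathrm{ALG}}$ (with accuracy $\eta_1$) and at most $B$ queries to $WSO_R^{\eta_2}$; * for every $\xi\in(0,1/2)$, with probability at least $1-2\xi$ over the perturbations, the expected reward of the output policy $\pi$ under every $w\in P_R$ is at least $$\max_{\mu\in P_F}\min_{w\in P_R}\mu\cdot w-\frac{k^2\big(6+4\sqrt{\ln(1/\xi)}\big)}{\sqrt T}-4c .$$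 (The maximum and minimum are read as supremum and infimum. For $c\ge 2k^2T$, where the formula for $\eta_2$ gives no positive accuracy and $\frac{\epsilon}{\epsilon+\eta_2}$ is read as $\frac{2k^2T-c}{2k^2T}$ if $c>2k^2T$ and as $1$ if $c=2k^2T$, the solver may return any policy on queries of non-positive accuracy and the claim still holds.) -/

import Mathlib

open MeasureTheory

noncomputable section

namespace MaxminFPL

universe u v w

/-! ## Markov decision processes, policies and feature expectations -/

/-- A Markov decision process without its reward function, together with the feature map
`φ : S → [0,1]^k`.  The reward of state `s` under weights `w` is `w ⬝ᵥ φ s`. -/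
structure MDP (S : Type u) (A : Type v) (k : ℕ) where
  trans : S → A → PMF S
  init : PMF S
  γ : ℝ
  γ_nonneg : 0 ≤ γ
  γ_lt_one : γ < 1
  φ : S → Fin k → ℝ
  φ_mem : ∀ s j, φ s j ∈ Set.Icc (0 : ℝ) 1

/-- A (stationary, possibly randomized) policy. -/
abbrev Policy (S : Type u) (A : Type v) := S → PMF A

section MDP

variable {S : Type u} {A : Type v} {k : ℕ}

/-- The law of the state `s_t` when policy `π` is followed. -/
def MDP.stateLaw (M : MDP S A k) (π : Policy S A) : ℕ → PMF S
  | 0 => M.init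
  | t + 1 => (M.stateLaw π t).bind fun s => (π s).bind fun a => M.trans s a

/-- `Ψ(π) = 𝔼[∑_t γ^t φ(s_t)]`, the accumulated discounted feature vector of `π`.  The value of
`π` under weights `w` is `w ⬝ᵥ Ψ(π)`. -/
def MDP.features [Fintype S] (M : MDP S A k) (π : Policy S A) : Fin k → ℝ :=
  fun j => ∑' t : ℕ, M.γ ^ t * ∑ s, (M.stateLaw π t s).toReal * M.φ s j

/-- `P_F`, the set of feature vectors of all policies. -/
def MDP.featureSet [Fintype S] (M : MDP S A k) : Set (Fin k → ℝ) :=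
  Set.range M.features

/-- `P_R`: the weights in `[-1,1]^k` under which the expert is at most `ε` worse than every
policy. -/
def MDP.consistentWeights [Fintype S] (M : MDP S A k) (πE : Policy S A) (ε : ℝ) :
    Set (Fin k → ℝ) :=
  {w | (∀ j, |w j| ≤ 1) ∧ ∀ μ ∈ M.featureSet, w ⬝ᵥ M.features πE ≥ w ⬝ᵥ μ - ε}

/-- `max_{μ ∈ P_F} min_{w ∈ P_R} μ · w`. -/
def MDP.maxminValue [Fintype S] (M : MDP S A k) (πE : Policy S A) (ε : ℝ) : ℝ :=
  sSup ((fun μ => sInf ((fun w => μ ⬝ᵥ w) '' M.consistentWeights πE ε)) '' M.featureSet)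

/-- Feature vector of the randomized policy `(1/T) ∑_t π_t`, which draws `t` uniformly at the
start and then follows `π_t` forever. -/
def MDP.mixtureFeatures [Fintype S] (M : MDP S A k) {T : ℕ} (π : Fin T → Policy S A) :
    Fin k → ℝ :=
  (1 / (T : ℝ)) • ∑ t, M.features (π t)

/-- `alg w η` is an `η`-optimal policy of the MDP with reward weights `w`, for every `w` and every
accuracy `η > 0`. -/
def MDP.IsApproxSolver [Fintype S] (M : MDP S A k)
    (alg : (Fin k → ℝ) → ℝ → Policy S A) : Prop :=
  ∀ w η, 0 < η → ∀ π : Policy S A, w ⬝ᵥ M.features (alg w η) ≥ w ⬝ᵥ M.features π - η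

/-- The weird separation oracle `WSO_R^η`.  The answer `none` means "YES"; the answer
`some (h, b)` means "NO", with the hyperplane `h ⬝ᵥ w + b ≥ 0`. -/
def MDP.wso [Fintype S] (M : MDP S A k) (alg : (Fin k → ℝ) → ℝ → Policy S A)
    (πE : Policy S A) (ε η : ℝ) (w' : Fin k → ℝ) : Option ((Fin k → ℝ) × ℝ) :=
  if M.features (alg w' η) ⬝ᵥ w' > M.features πE ⬝ᵥ w' + ε then
    some (M.features πE - M.features (alg w' η), ε)
  else none

end MDP

/-! ## Programs with oracle access -/

/-- Programs whose only access to the environment is through queries to an MDP solver (which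
returns a policy and its feature vector) and to a separation oracle. -/
inductive OracleProg (k : ℕ) (Pol : Type u) (α : Type v) : Type (max u v) where
  | ret (a : α) : OracleProg k Pol α
  | callALG (w : Fin k → ℝ) (η : ℝ) (cont : Pol → (Fin k → ℝ) → OracleProg k Pol α) :
      OracleProg k Pol α
  | callWSO (w : Fin k → ℝ) (cont : Option ((Fin k → ℝ) × ℝ) → OracleProg k Pol α) :
      OracleProg k Pol α

namespace OracleProg

variable {k : ℕ} {Pol : Type u} {α : Type v} {β : Type w}

/-- Sequential composition. -/
def bind : OracleProg k Pol α → (α → OracleProg k Pol β) → OracleProg k Pol β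
  | ret a, f => f a
  | callALG w η cont, f => callALG w η fun π μ => (cont π μ).bind f
  | callWSO w cont, f => callWSO w fun r => (cont r).bind f

/-- The result of a run. -/
def eval (alg : (Fin k → ℝ) → ℝ → Pol) (Ψ : Pol → Fin k → ℝ)
    (wso : (Fin k → ℝ) → Option ((Fin k → ℝ) × ℝ)) : OracleProg k Pol α → α
  | ret a => a
  | callALG w η cont => (cont (alg w η) (Ψ (alg w η))).eval alg Ψ wso
  | callWSO w cont => (cont (wso w)).eval alg Ψ wso

/-- The number of queries to the MDP solver in a run. -/
def algQueries (alg : (Fin k → ℝ) → ℝ → Pol) (Ψ : Pol → Fin k → ℝ)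
    (wso : (Fin k → ℝ) → Option ((Fin k → ℝ) × ℝ)) : OracleProg k Pol α → ℕ
  | ret _ => 0
  | callALG w η cont => (cont (alg w η) (Ψ (alg w η))).algQueries alg Ψ wso + 1
  | callWSO w cont => (cont (wso w)).algQueries alg Ψ wso

/-- The number of queries to the separation oracle in a run. -/
def wsoQueries (alg : (Fin k → ℝ) → ℝ → Pol) (Ψ : Pol → Fin k → ℝ)
    (wso : (Fin k → ℝ) → Option ((Fin k → ℝ) × ℝ)) : OracleProg k Pol α → ℕ
  | ret _ => 0
  | callALG w η cont => (cont (alg w η) (Ψ (alg w η))).wsoQueries alg Ψ wso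
  | callWSO w cont => (cont (wso w)).wsoQueries alg Ψ wso + 1

end OracleProg

/-! ## Linear optimization with the ellipsoid method -/

section Ellipsoid

variable {k : ℕ} {Pol : Type u}

/-- The smallest ellipsoid that contains the half `{y ∈ E | g ⬝ᵥ y ≤ g ⬝ᵥ x}` of the ellipsoid
`E = {y | (y - x)ᵀ Q⁻¹ (y - x) ≤ 1}`, where `E` is stored as the pair `(x, Q)`. -/
def ellipsoidCut (E : (Fin k → ℝ) × Matrix (Fin k) (Fin k) ℝ) (g : Fin k → ℝ) :
    (Fin k → ℝ) × Matrix (Fin k) (Fin k) ℝ :=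
  let b := E.2.mulVec g
  let r := g ⬝ᵥ b
  (E.1 - (1 / (((k : ℝ) + 1) * Real.sqrt r)) • b,
   if k = 1 then (1 / 4 : ℝ) • E.2
   else ((k : ℝ) ^ 2 / ((k : ℝ) ^ 2 - 1)) •
      (E.2 - (2 / (((k : ℝ) + 1) * r)) • Matrix.vecMulVec b b))

/-- The normal of a hyperplane that separates a point `x ∉ [-1,1]^k` from the cube. -/
def boxCut (x : Fin k → ℝ) : Fin k → ℝ :=
  fun j => if 1 < x j then 1 else if x j < -1 then -1 else 0

/-- `N` iterations of the ellipsoid method for finding a point `x ∈ [-1,1]^k` with `s ⬝ᵥ x ≤ a`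
that the separation oracle accepts.  The oracle is queried only at points that satisfy the
explicitly known constraints. -/
def ellipsoidSearch (s : Fin k → ℝ) (a : ℝ) :
    ℕ → (Fin k → ℝ) × Matrix (Fin k) (Fin k) ℝ → OracleProg k Pol (Option (Fin k → ℝ))
  | 0, _ => .ret none
  | n + 1, E =>
    if ∃ j, 1 < |E.1 j| then ellipsoidSearch s a n (ellipsoidCut E (boxCut E.1))
    else if a < s ⬝ᵥ E.1 then ellipsoidSearch s a n (ellipsoidCut E s)
    else .callWSO E.1 fun answer =>
      match answer with
      | none => .ret (some E.1)
      | some (h, _) => ellipsoidSearch s a n (ellipsoidCut E (-h))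

/-- The ball of radius `√k` about the origin, which contains `[-1,1]^k`. -/
def initialEllipsoid (k : ℕ) : (Fin k → ℝ) × Matrix (Fin k) (Fin k) ℝ :=
  (0, (k : ℝ) • (1 : Matrix (Fin k) (Fin k) ℝ))

/-- Binary search on the objective value, each step being one run of `N` ellipsoid iterations.
`best` is the best point found so far. -/
def binarySearch (s : Fin k → ℝ) (N : ℕ) :
    ℕ → ℝ → ℝ → (Fin k → ℝ) → OracleProg k Pol (Fin k → ℝ)
  | 0, _, _, best => .ret best
  | j + 1, lo, hi, best =>
    (ellipsoidSearch s ((lo + hi) / 2) N (initialEllipsoid k)).bind fun res =>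
      match res with
      | some x => binarySearch s N j lo ((lo + hi) / 2) x
      | none => binarySearch s N j ((lo + hi) / 2) hi best

/-- Minimization of `s ⬝ᵥ w` with the separation oracle: `J` binary search steps of `N` ellipsoid
iterations each.  The weight `0` is consistent with every expert, so it is the first incumbent
and the optimal value lies between `-‖s‖₁` and `0`. -/
def lpMinimize (s : Fin k → ℝ) (N J : ℕ) : OracleProg k Pol (Fin k → ℝ) :=
  binarySearch s N J (-∑ j, |s j|) 0 0

end Ellipsoid

/-! ## Follow the perturbed leader -/

section FPL

/-- `δ = 1 / (k √T)`. -/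
def delta (k T : ℕ) : ℝ := 1 / ((k : ℝ) * Real.sqrt T)

/-- `η₁ = c / (2T)`. -/
def eta₁ (T : ℕ) (c : ℝ) : ℝ := c / (2 * (T : ℝ))

/-- `η₂ = c ε / (2 k² T - c)`. -/
def eta₂ (k T : ℕ) (ε c : ℝ) : ℝ := c * ε / (2 * (k : ℝ) ^ 2 * (T : ℝ) - c)

/-- What one round produces: `π_t`, `μ_t = Ψ(π_t)` and `w_t`. -/
structure RoundOutput (k : ℕ) (Pol : Type u) where
  policy : Pol
  feature : Fin k → ℝ
  weight : Fin k → ℝ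

/-- One round of the algorithm, where `W = ∑_{i<t} w_i`, `m = ∑_{i<t} μ_i`, and `p`, `q` are the
perturbations of this round. -/
def roundProg {k : ℕ} {Pol : Type u} (T : ℕ) (ε c : ℝ) (N J : ℕ) (W m p q : Fin k → ℝ) :
    OracleProg k Pol (RoundOutput k Pol) :=
  .callALG ((1 / (T : ℝ)) • (W + p)) (eta₁ T c) fun π μ =>
    (lpMinimize (m + q) N J).bind fun w' =>
      .ret ⟨π, μ, (ε / (ε + eta₂ k T ε c)) • w'⟩

variable {S : Type u} {A : Type v} {k : ℕ}

/-- The sums `(∑_{i<t} w_i, ∑_{i<t} μ_i)` at the beginning of round `t` (rounds are numbered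
`0, …, T - 1`). -/
def sumsBefore [Fintype S] (M : MDP S A k) (alg : (Fin k → ℝ) → ℝ → Policy S A)
    (πE : Policy S A) (T : ℕ) (ε c : ℝ) (N J : ℕ) (p q : Fin T → Fin k → ℝ) :
    ℕ → (Fin k → ℝ) × (Fin k → ℝ)
  | 0 => (0, 0)
  | t + 1 =>
    let h := sumsBefore M alg πE T ε c N J p q t
    if ht : t < T then
      let out := (roundProg T ε c N J h.1 h.2 (p ⟨t, ht⟩) (q ⟨t, ht⟩)).eval alg M.features
        (M.wso alg πE ε (eta₂ k T ε c))
      (h.1 + out.weight, h.2 + out.feature)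
    else h

/-- The program that the algorithm executes in round `t`. -/
def roundAt [Fintype S] (M : MDP S A k) (alg : (Fin k → ℝ) → ℝ → Policy S A)
    (πE : Policy S A) (T : ℕ) (ε c : ℝ) (N J : ℕ) (p q : Fin T → Fin k → ℝ) (t : Fin T) :
    OracleProg k (Policy S A) (RoundOutput k (Policy S A)) :=
  let h := sumsBefore M alg πE T ε c N J p q t
  roundProg T ε c N J h.1 h.2 (p t) (q t)

/-- The policies `π_t` of the `T` rounds. -/
def policies [Fintype S] (M : MDP S A k) (alg : (Fin k → ℝ) → ℝ → Policy S A)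
    (πE : Policy S A) (T : ℕ) (ε c : ℝ) (N J : ℕ) (p q : Fin T → Fin k → ℝ) (t : Fin T) :
    Policy S A :=
  ((roundAt M alg πE T ε c N J p q t).eval alg M.features
    (M.wso alg πE ε (eta₂ k T ε c))).policy

/-- The joint law of `(p_t)_t` for `T` independent vectors, each uniform on `[0, 1/δ]^k`. -/
def perturbationLaw (k T : ℕ) : Measure (Fin T → Fin k → ℝ) :=
  Measure.pi fun _ =>
    ProbabilityTheory.cond volume (Set.Icc (0 : Fin k → ℝ) (fun _ => 1 / delta k T))

end FPL

end MaxminFPL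

end

open MaxminFPL

namespace MaxminFPL

/-! ## The central cut -/

section CentralCut

open Matrix

variable {k : ℕ}

/-! The algorithm lets two learners play the zero-sum game with payoff `μ ⬝ᵥ w` against each other.
The feature player maximizes over `P_F`, the weight player minimizes over `P_R`, and both follow the
perturbed leader. Fix any realized run with plays `m t` and `y t`. Each player's regret bound
(`fpl_regret`) holds for every sequence of opposing plays, so it applies to this run, with the loss
of round `t` averaged over a fresh copy of the player's own perturbation.

The two bounds involve different averages of the payoff of round `t`: one over the feature player's
perturbation, the other over the weight player's. Given the past, both have the same mean, so their
differences (`gameNoise`) are bounded martingale differences, and Azuma–Hoeffding bounds their sum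
(`gameNoise_concentration`). On this single event the bounds chain, for every `w ∈ P_R` and every
policy `π`, to `∑ Ψ(π) ⬝ᵥ y t ≤ ∑ m t ⬝ᵥ w + error`. The average of the `y t` lies in the convex set
`P_R`, so the maxmin value is at most the reward of the output plus `error / T`. No minimax theorem
and no union bound over `w` is needed (`guarantee_of_noise_le`).

It remains to see that the weight player nearly minimizes over `P_R` (`weightPlay_spec`). A NO of
the oracle strictly separates the query from `P_R`; an accepted point lies in `P_R` after scaling by
`ε / (ε + η₂)`. Around a point shrunk towards the origin, `P_R` contains a small cube. Each central
cut keeps the feasible region inside the ellipsoid and multiplies the determinant by at most `exp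
(-1/(k+1))`, so polynomially many cuts without acceptance would leave an ellipsoid too small for
that cube. Binary search then locates the optimal value. -/

/-- Membership in the ellipsoid with center `E.1` and shape matrix `E.2`, in terms of its support
function. -/
def InEllipsoid (E : (Fin k → ℝ) × Matrix (Fin k) (Fin k) ℝ) (y : Fin k → ℝ) : Prop :=
  ∀ g : Fin k → ℝ, (g ⬝ᵥ (y - E.1)) ^ 2 ≤ g ⬝ᵥ E.2 *ᵥ g

/-- The difference of the two sides is a nonnegative quadratic in `α`, so its discriminant is
nonpositive. This turns the support-function form of membership into the equation of an ellipse in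
the coordinates `(τ, σ)`. -/
lemma sq_le_of_forall_comb_sq_le {τ σ H : ℝ}
    (h : ∀ α : ℝ, (α * τ + σ) ^ 2 ≤ α ^ 2 + H) : σ ^ 2 ≤ H * (1 - τ ^ 2) := by
  have := discrim_le_zero (a := 1 - τ ^ 2) (b := -(2 * τ * σ)) (c := H - σ ^ 2)
    (fun α => by nlinarith [h α])
  unfold discrim at this
  nlinarith

/-- The planar core of the cut: `τ` is the normalized coordinate along the cut, `σ` the transverse
part. In coordinates adapted to the new ellipsoid the half disk satisfies `u² + V ≤ 1`, and
Cauchy–Schwarz turns this into the support inequality. -/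
lemma half_disk_bound {n l H τ σ : ℝ} (hn : 1 < n) (h1 : -1 ≤ τ) (h0 : τ ≤ 0)
    (hσ : σ ^ 2 ≤ H * (1 - τ ^ 2)) (hH : 0 ≤ H) :
    (l * (τ + 1 / (n + 1)) + σ) ^ 2 ≤
      n ^ 2 / (n ^ 2 - 1) * (l ^ 2 * (1 - 2 / (n + 1)) + H) := by
  have hn1 : 0 < n - 1 := by linarith
  have hn2 : 0 < n + 1 := by linarith
  have hn3 : n ^ 2 - 1 ≠ 0 := by nlinarith
  have hτ : 0 ≤ 1 - τ ^ 2 := by nlinarith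
  set u := (τ + 1 / (n + 1)) * (n + 1) / n with hu
  set P := l * (n / (n + 1)) with hP
  set G := n ^ 2 / (n ^ 2 - 1) * H with hG
  set V := (1 - τ ^ 2) * (n ^ 2 - 1) / n ^ 2 with hV
  have hG0 : 0 ≤ G := by
    have : 0 < n ^ 2 - 1 := by nlinarith
    positivity
  have hV0 : 0 ≤ V := by
    have : 0 < n ^ 2 - 1 := by nlinarith
    positivity
  have e1 : l * (τ + 1 / (n + 1)) = P * u := by
    rw [hP, hu]; field_simp
  have e2 : n ^ 2 / (n ^ 2 - 1) * (l ^ 2 * (1 - 2 / (n + 1)) + H) = P ^ 2 + G := by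
    rw [hP, hG]; field_simp; ring
  have e3 : H * (1 - τ ^ 2) = G * V := by
    rw [hG, hV]; field_simp
  have e4 : u ^ 2 + V ≤ 1 := by
    -- The slack vanishes exactly at `τ = 0` and `τ = -1`, where the new ellipsoid touches the half
    -- disk.
    have : 1 - (u ^ 2 + V) = 2 * (n + 1) * (-τ * (τ + 1)) / n ^ 2 := by
      rw [hu, hV]; field_simp; ring
    have h2 : 0 ≤ 2 * (n + 1) * (-τ * (τ + 1)) / n ^ 2 := by
      apply div_nonneg _ (sq_nonneg _)
      apply mul_nonneg (by linarith)
      nlinarith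
    linarith
  rw [e1, e2]
  rw [e3] at hσ
  have hs : |σ| ≤ √G * √V := by
    rw [← Real.sqrt_mul hG0]
    exact Real.abs_le_sqrt hσ
  have hg : √G ^ 2 = G := Real.sq_sqrt hG0
  have hv : √V ^ 2 = V := Real.sq_sqrt hV0
  have hc : P * u * σ ≤ |P * u| * (√G * √V) :=
    (le_abs_self _).trans ((abs_mul _ _).le.trans (mul_le_mul_of_nonneg_left hs (abs_nonneg _)))
  have hd : 2 * (|P * u| * (√G * √V)) ≤ P ^ 2 * V + u ^ 2 * G := by
    have := sq_nonneg (|P| * √V - |u| * √G)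
    rw [abs_mul]
    have a1 : |P| ^ 2 = P ^ 2 := sq_abs P
    have a2 : |u| ^ 2 = u ^ 2 := sq_abs u
    calc 2 * (|P| * |u| * (√G * √V)) ≤ (|P| * √V) ^ 2 + (|u| * √G) ^ 2 := by linarith
      _ = P ^ 2 * V + u ^ 2 * G := by rw [mul_pow, mul_pow, a1, a2, hg, hv]
  nlinarith [sq_nonneg P]

lemma quad_comb {Q : Matrix (Fin k) (Fin k) ℝ} (hQ : Qᵀ = Q) (a b : ℝ) (g h : Fin k → ℝ) :
    (a • g + b • h) ⬝ᵥ Q *ᵥ (a • g + b • h)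
      = a ^ 2 * (g ⬝ᵥ Q *ᵥ g) + 2 * a * b * (g ⬝ᵥ Q *ᵥ h) + b ^ 2 * (h ⬝ᵥ Q *ᵥ h) := by
  have hs : h ⬝ᵥ Q *ᵥ g = g ⬝ᵥ Q *ᵥ h := by
    rw [dotProduct_mulVec, ← mulVec_transpose, hQ, dotProduct_comm]
  simp only [mulVec_add, mulVec_smul, add_dotProduct, dotProduct_add, smul_dotProduct,
    dotProduct_smul, smul_eq_mul, hs]
  ring

lemma ellipsoidCut_quad {E : (Fin k → ℝ) × Matrix (Fin k) (Fin k) ℝ} {g₀ : Fin k → ℝ}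
    (hk : k ≠ 1) (g : Fin k → ℝ) :
    g ⬝ᵥ (ellipsoidCut E g₀).2 *ᵥ g = (k : ℝ) ^ 2 / ((k : ℝ) ^ 2 - 1) *
      (g ⬝ᵥ E.2 *ᵥ g - 2 / (((k : ℝ) + 1) * (g₀ ⬝ᵥ E.2 *ᵥ g₀)) * (g ⬝ᵥ E.2 *ᵥ g₀) ^ 2) := by
  simp only [ellipsoidCut, if_neg hk, smul_mulVec, sub_mulVec, vecMulVec_mulVec, dotProduct_smul,
    dotProduct_sub, smul_eq_mul, op_smul_eq_smul]
  rw [dotProduct_comm (E.2 *ᵥ g₀) g]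
  ring

/-- Decomposition of the quadratic form along `g₀` and its `Q`-orthogonal complement. -/
lemma quad_sub_nonneg {Q : Matrix (Fin k) (Fin k) ℝ} (hQ : Q.PosDef) {g₀ : Fin k → ℝ}
    (hr : 0 < g₀ ⬝ᵥ Q *ᵥ g₀) (g : Fin k → ℝ) :
    0 ≤ g ⬝ᵥ Q *ᵥ g - (g ⬝ᵥ Q *ᵥ g₀) ^ 2 / (g₀ ⬝ᵥ Q *ᵥ g₀) := by
  have hT : Qᵀ = Q := by simpa [IsHermitian] using hQ.1
  have h := hQ.posSemidef.dotProduct_mulVec_nonneg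
    ((1 : ℝ) • g + (-(g ⬝ᵥ Q *ᵥ g₀) / (g₀ ⬝ᵥ Q *ᵥ g₀)) • g₀)
  rw [star_trivial, quad_comb hT] at h
  refine h.trans_eq ?_
  generalize g₀ ⬝ᵥ Q *ᵥ g₀ = r at hr
  field_simp
  ring

lemma posDef_ellipsoidCut {E : (Fin k → ℝ) × Matrix (Fin k) (Fin k) ℝ} (hE : E.2.PosDef)
    (hk : 0 < k) {g₀ : Fin k → ℝ} (hg₀ : g₀ ≠ 0) : (ellipsoidCut E g₀).2.PosDef := by
  have hT : E.2ᵀ = E.2 := by simpa [IsHermitian] using hE.1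
  have hr : 0 < g₀ ⬝ᵥ E.2 *ᵥ g₀ := by simpa using hE.dotProduct_mulVec_pos hg₀
  by_cases h1 : k = 1
  · simp only [ellipsoidCut, if_pos h1]
    exact hE.smul (by norm_num)
  have hk2 : (1 : ℝ) < k := by exact_mod_cast (by omega : 1 < k)
  refine PosDef.of_dotProduct_mulVec_pos ?_ fun g hg => ?_
  · simp only [ellipsoidCut, if_neg h1, IsHermitian, conjTranspose_eq_transpose_of_trivial,
      transpose_smul, transpose_sub, hT, transpose_vecMulVec]
  · rw [star_trivial, ellipsoidCut_quad h1]
    have hpos : 0 < g ⬝ᵥ E.2 *ᵥ g := by simpa using hE.dotProduct_mulVec_pos hg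
    have hn := quad_sub_nonneg hE hr g
    have hk3 : 0 < (k : ℝ) ^ 2 - 1 := by nlinarith
    apply mul_pos (by positivity)
    have e : 2 / (((k : ℝ) + 1) * (g₀ ⬝ᵥ E.2 *ᵥ g₀)) * (g ⬝ᵥ E.2 *ᵥ g₀) ^ 2
        = 2 / ((k : ℝ) + 1) * ((g ⬝ᵥ E.2 *ᵥ g₀) ^ 2 / (g₀ ⬝ᵥ E.2 *ᵥ g₀)) := by
      field_simp
    rw [e]
    have h2 : 2 / ((k : ℝ) + 1) < 1 := by
      rw [div_lt_one (by linarith)]; linarith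
    have h3 : 0 ≤ 2 / ((k : ℝ) + 1) := by positivity
    have h4 : 2 / ((k : ℝ) + 1) * ((g ⬝ᵥ E.2 *ᵥ g₀) ^ 2 / (g₀ ⬝ᵥ E.2 *ᵥ g₀))
        ≤ 2 / ((k : ℝ) + 1) * (g ⬝ᵥ E.2 *ᵥ g) :=
      mul_le_mul_of_nonneg_left (by linarith) h3
    nlinarith

/-- Splitting `g` into its component along `g₀` and a `Q`-orthogonal rest reduces the claim to two
dimensions. The old membership, tested on all combinations of the two, gives the ellipse; the cut
gives `τ ≤ 0`. -/
lemma InEllipsoid.ellipsoidCut {E : (Fin k → ℝ) × Matrix (Fin k) (Fin k) ℝ} (hE : E.2.PosDef)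
    (hk : 0 < k) {g₀ y : Fin k → ℝ} (hg₀ : g₀ ≠ 0) (hy : InEllipsoid E y)
    (hcut : g₀ ⬝ᵥ y ≤ g₀ ⬝ᵥ E.1) : InEllipsoid (ellipsoidCut E g₀) y := by
  intro g
  have hT : E.2ᵀ = E.2 := by simpa [IsHermitian] using hE.1
  have hr : 0 < g₀ ⬝ᵥ E.2 *ᵥ g₀ := by simpa using hE.dotProduct_mulVec_pos hg₀
  obtain ⟨r, hrd⟩ : ∃ r, r = g₀ ⬝ᵥ E.2 *ᵥ g₀ := ⟨_, rfl⟩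
  obtain ⟨l, hld⟩ : ∃ l, l = g ⬝ᵥ E.2 *ᵥ g₀ := ⟨_, rfl⟩
  obtain ⟨z, hz⟩ : ∃ z, z = y - E.1 := ⟨_, rfl⟩
  obtain ⟨ρ, hρ⟩ : ∃ ρ, ρ = √r := ⟨_, rfl⟩
  rw [← hrd] at hr
  have hρ0 : 0 < ρ := hρ ▸ Real.sqrt_pos.2 hr
  have hρ2 : ρ ^ 2 = r := by rw [hρ, Real.sq_sqrt hr.le]
  have hH := quad_sub_nonneg hE (hrd ▸ hr) g
  rw [← hrd, ← hld] at hH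
  have hcross : ∀ α : ℝ, (α * (g₀ ⬝ᵥ z / ρ) + (g ⬝ᵥ z - l / r * (g₀ ⬝ᵥ z))) ^ 2
      ≤ α ^ 2 + (g ⬝ᵥ E.2 *ᵥ g - l ^ 2 / r) := by
    intro α
    have h := hy ((1 : ℝ) • g + (α / ρ - l / r) • g₀)
    rw [quad_comb hT, ← hld, ← hrd, ← hz] at h
    simp only [add_dotProduct, smul_dotProduct, smul_eq_mul] at h
    calc _ = (1 * g ⬝ᵥ z + (α / ρ - l / r) * g₀ ⬝ᵥ z) ^ 2 := by ring
      _ ≤ _ := h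
      _ = _ := by rw [← hρ2]; field_simp; ring
  have hτ0 : g₀ ⬝ᵥ z / ρ ≤ 0 := by
    apply div_nonpos_of_nonpos_of_nonneg _ hρ0.le
    rw [hz, dotProduct_sub]; linarith
  have hτ1 : -1 ≤ g₀ ⬝ᵥ z / ρ := by
    have h := hy g₀
    rw [← hrd, ← hz, ← hρ2] at h
    rw [le_div_iff₀ hρ0]
    have := abs_le_of_sq_le_sq' h hρ0.le
    linarith [this.1]
  have hσ := sq_le_of_forall_comb_sq_le hcross
  have hval : g ⬝ᵥ (y - (MaxminFPL.ellipsoidCut E g₀).1)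
      = l / ρ * (g₀ ⬝ᵥ z / ρ + 1 / ((k : ℝ) + 1)) + (g ⬝ᵥ z - l / r * (g₀ ⬝ᵥ z)) := by
    simp only [MaxminFPL.ellipsoidCut]
    rw [← sub_add, ← hz, dotProduct_add, dotProduct_smul, ← hrd, ← hld, ← hρ, ← hρ2, smul_eq_mul]
    field_simp
    ring
  rw [hval]
  -- In dimension one the factor `k² / (k² - 1)` is meaningless and the cut halves an interval: `g`
  -- is a multiple of `g₀` and `-1 ≤ τ ≤ 0` means `|τ + 1/2| ≤ 1/2`.
  by_cases h1 : k = 1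
  · subst h1
    have hgg : ∃ a : ℝ, g = a • g₀ := by
      have h0 : g₀ 0 ≠ 0 := by
        intro h; apply hg₀; ext i; rw [Subsingleton.elim i 0]; exact h
      refine ⟨g 0 / g₀ 0, ?_⟩
      ext i; rw [Subsingleton.elim i 0]; simp [h0]
    obtain ⟨a, rfl⟩ := hgg
    have hl : l = a * r := by rw [hld, smul_dotProduct, ← hrd, smul_eq_mul]
    have hq : (a • g₀) ⬝ᵥ (MaxminFPL.ellipsoidCut E g₀).2 *ᵥ (a • g₀) = (a * ρ) ^ 2 / 4 := by
      simp only [MaxminFPL.ellipsoidCut, if_true, smul_mulVec, mulVec_smul, smul_dotProduct,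
        dotProduct_smul, ← hrd, smul_eq_mul]
      rw [← hρ2]; ring
    rw [hq, hl, ← hρ2]
    have e : a * ρ ^ 2 / ρ * (g₀ ⬝ᵥ z / ρ + 1 / (((1 : ℕ) : ℝ) + 1)) +
        ((a • g₀) ⬝ᵥ z - a * ρ ^ 2 / ρ ^ 2 * g₀ ⬝ᵥ z) = a * ρ * (g₀ ⬝ᵥ z / ρ + 1 / 2) := by
      rw [smul_dotProduct, smul_eq_mul]; push_cast; field_simp; ring
    rw [e, mul_pow]
    have : (g₀ ⬝ᵥ z / ρ + 1 / 2) ^ 2 ≤ 1 / 4 := by nlinarith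
    nlinarith [sq_nonneg (a * ρ)]
  · rw [ellipsoidCut_quad h1, ← hrd, ← hld]
    have hk2 : (1 : ℝ) < k := by exact_mod_cast (by omega : 1 < k)
    refine (half_disk_bound hk2 hτ1 hτ0 hσ hH).trans (le_of_eq ?_)
    rw [← hρ2]
    have : (k : ℝ) ^ 2 - 1 ≠ 0 := by nlinarith
    field_simp
    ring

/-! ### Volume decrease and the volume lower bound -/

lemma ellipsoid_det_factor {n : ℕ} (hn : 2 ≤ n) :
    ((n : ℝ) ^ 2 / ((n : ℝ) ^ 2 - 1)) ^ n * (1 - 2 / ((n : ℝ) + 1))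
      ≤ Real.exp (-(1 / ((n : ℝ) + 1))) := by
  obtain ⟨m, rfl⟩ : ∃ m, n = m + 1 := ⟨n - 1, by omega⟩
  have hm : (1 : ℝ) ≤ m := by exact_mod_cast (by omega : 1 ≤ m)
  set x : ℝ := ((m + 1 : ℕ) : ℝ) with hx
  have hxm : x = m + 1 := by rw [hx]; push_cast; ring
  have hx2 : 0 < x ^ 2 - 1 := by rw [hxm]; nlinarith
  have hx1 : 0 < x - 1 := by rw [hxm]; linarith
  have hx0 : 0 < x + 1 := by rw [hxm]; linarith
  have e1 : (x ^ 2 / (x ^ 2 - 1)) ^ (m + 1) * (1 - 2 / (x + 1))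
      = (1 + 1 / (x ^ 2 - 1)) ^ m * (1 - 1 / (x + 1)) ^ 2 := by
    have : x ^ 2 / (x ^ 2 - 1) = 1 + 1 / (x ^ 2 - 1) := by field_simp; ring
    -- One of the `n` factors is absorbed into `1 - 2/(n+1)` to give a square; the other `n - 1`
    -- contribute at most `exp (1/(n+1))`, the square at most `exp (-2/(n+1))`.
    rw [pow_succ, ← this, mul_assoc]
    congr 1
    field_simp
    ring
  rw [e1]
  have h1 : (1 + 1 / (x ^ 2 - 1)) ^ m ≤ Real.exp (1 / (x + 1)) := by
    calc (1 + 1 / (x ^ 2 - 1)) ^ m ≤ (Real.exp (1 / (x ^ 2 - 1))) ^ m := by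
          gcongr
          linarith [Real.add_one_le_exp (1 / (x ^ 2 - 1))]
      _ = Real.exp (1 / (x + 1)) := by
          rw [← Real.exp_nat_mul]
          congr 1
          have : (m : ℝ) = x - 1 := by rw [hxm]; ring
          rw [this]
          field_simp
          ring
  have h2 : (1 - 1 / (x + 1)) ^ 2 ≤ Real.exp (-(2 / (x + 1))) := by
    have h3 : 0 ≤ 1 - 1 / (x + 1) := by
      rw [sub_nonneg, div_le_one hx0]; linarith
    calc (1 - 1 / (x + 1)) ^ 2 ≤ (Real.exp (-(1 / (x + 1)))) ^ 2 := by
          gcongr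
          linarith [Real.add_one_le_exp (-(1 / (x + 1)))]
      _ = _ := by
          rw [← Real.exp_nat_mul]; congr 1; push_cast; ring
  calc _ ≤ Real.exp (1 / (x + 1)) * Real.exp (-(2 / (x + 1))) := by gcongr
    _ = _ := by rw [← Real.exp_add]; congr 1; ring

lemma det_ellipsoidCut_le {E : (Fin k → ℝ) × Matrix (Fin k) (Fin k) ℝ} (hE : E.2.PosDef)
    (hk : 0 < k) {g₀ : Fin k → ℝ} (hg₀ : g₀ ≠ 0) :
    (ellipsoidCut E g₀).2.det ≤ Real.exp (-(1 / ((k : ℝ) + 1))) * E.2.det := by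
  have hT : E.2ᵀ = E.2 := by simpa [IsHermitian] using hE.1
  have hr : 0 < g₀ ⬝ᵥ E.2 *ᵥ g₀ := by simpa using hE.dotProduct_mulVec_pos hg₀
  have hd := hE.det_pos
  by_cases h1 : k = 1
  · subst h1
    simp only [ellipsoidCut, if_true, det_smul]
    apply mul_le_mul_of_nonneg_right _ hd.le
    have := Real.add_one_le_exp (-(1 / (((1 : ℕ) : ℝ) + 1)))
    refine le_trans ?_ this
    norm_num
  -- The update has rank one, so after factoring out `Q` the matrix determinant lemma applies.
  · have e : E.2 - (2 / (((k : ℝ) + 1) * (g₀ ⬝ᵥ E.2 *ᵥ g₀))) • vecMulVec (E.2 *ᵥ g₀) (E.2 *ᵥ g₀)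
        = E.2 * (1 - replicateCol Unit g₀ * replicateRow Unit
            ((2 / (((k : ℝ) + 1) * (g₀ ⬝ᵥ E.2 *ᵥ g₀))) • (E.2 *ᵥ g₀))) := by
      rw [mul_sub, mul_one, ← vecMulVec_eq, mul_vecMulVec, vecMulVec_smul]
    have h2 : ((1 : Matrix (Fin k) (Fin k) ℝ) - replicateCol Unit g₀ * replicateRow Unit
            ((2 / (((k : ℝ) + 1) * (g₀ ⬝ᵥ E.2 *ᵥ g₀))) • (E.2 *ᵥ g₀))).det
          = 1 - 2 / ((k : ℝ) + 1) := by
      rw [det_one_sub_mul_comm, det_unique]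
      simp only [Matrix.sub_apply, one_apply_eq, replicateRow_mul_replicateCol_apply, smul_dotProduct,
        smul_eq_mul]
      rw [dotProduct_comm (E.2 *ᵥ g₀) g₀]
      field_simp
    have h3 : (ellipsoidCut E g₀).2.det = ((k : ℝ) ^ 2 / ((k : ℝ) ^ 2 - 1)) ^ k
        * (1 - 2 / ((k : ℝ) + 1)) * E.2.det := by
      simp only [ellipsoidCut, if_neg h1]
      rw [e, det_smul, det_mul, h2, Fintype.card_fin]
      ring
    rw [h3]
    exact mul_le_mul_of_nonneg_right (ellipsoid_det_factor (by omega)) hd.le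

/-- An ellipsoid that contains a cube of half-width `ρ` has determinant at least `ρ ^ (2k)`. -/
lemma pow_le_det_of_cube_subset {E : (Fin k → ℝ) × Matrix (Fin k) (Fin k) ℝ} (hE : E.2.PosDef)
    {x : Fin k → ℝ} {ρ : ℝ}
    (h : ∀ u : Fin k → ℝ, (∀ j, |u j| ≤ 1) → InEllipsoid E (x + ρ • u)) :
    (ρ ^ 2) ^ k ≤ E.2.det := by
  rw [hE.1.det_eq_prod_eigenvalues]
  have key : ∀ i, ρ ^ 2 ≤ hE.1.eigenvalues i := by
    intro i
    set v : Fin k → ℝ := (hE.1.eigenvectorBasis i).ofLp with hv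
    have hvv : v ⬝ᵥ v = 1 := by
      have := hE.1.eigenvectorBasis.orthonormal.1 i
      have h2 : ‖hE.1.eigenvectorBasis i‖ ^ 2 = 1 := by rw [this]; norm_num
      rw [EuclideanSpace.norm_sq_eq] at h2
      simp only [Real.norm_eq_abs, sq_abs] at h2
      rw [dotProduct, ← h2]
      exact Finset.sum_congr rfl fun j _ => (sq _).symm
    have hQv : v ⬝ᵥ E.2 *ᵥ v = hE.1.eigenvalues i := by
      rw [hv, hE.1.mulVec_eigenvectorBasis i, dotProduct_smul, ← hv, hvv]
      simp
    have hle : ∀ j, |v j| ≤ 1 := by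
      intro j
      rw [← sq_le_one_iff_abs_le_one, ← hvv, dotProduct, sq]
      exact Finset.single_le_sum (f := fun j => v j * v j) (fun j _ => mul_self_nonneg _)
        (Finset.mem_univ j)
    -- A unit eigenvector has entries at most one in absolute value, so `x ± ρ v` both lie in the
    -- ellipsoid; testing them against `v` forces the eigenvalue to be at least `ρ²`.
    have h1 := h v hle v
    have h2 := h (-v) (fun j => by simpa using hle j) v
    rw [hQv] at h1 h2
    rw [add_sub_right_comm, dotProduct_add, dotProduct_smul, smul_eq_mul] at h1 h2
    rw [dotProduct_neg, hvv] at h2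
    rw [hvv] at h1
    nlinarith [sq_nonneg (v ⬝ᵥ (x - E.1))]
  calc (ρ ^ 2) ^ k = ∏ _i : Fin k, ρ ^ 2 := by simp
    _ ≤ ∏ i, hE.1.eigenvalues i := Finset.prod_le_prod (fun _ _ => sq_nonneg ρ) fun i _ => key i
    _ = _ := by simp

end CentralCut

end MaxminFPL

namespace MaxminFPL

universe u v w

/-! ## Runs of oracle programs -/

namespace OracleProg

variable {k : ℕ} {Pol : Type u} {α : Type v} {β : Type w} (alg : (Fin k → ℝ) → ℝ → Pol)
  (Ψ : Pol → Fin k → ℝ) (wso : (Fin k → ℝ) → Option ((Fin k → ℝ) × ℝ))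

lemma eval_bind (p : OracleProg k Pol α) (f : α → OracleProg k Pol β) :
    (p.bind f).eval alg Ψ wso = (f (p.eval alg Ψ wso)).eval alg Ψ wso := by
  induction p with
  | ret a => rfl
  | callALG w η cont ih => exact ih _ _
  | callWSO w cont ih => exact ih _

lemma algQueries_bind (p : OracleProg k Pol α) (f : α → OracleProg k Pol β) :
    (p.bind f).algQueries alg Ψ wso
      = p.algQueries alg Ψ wso + (f (p.eval alg Ψ wso)).algQueries alg Ψ wso := by
  induction p with
  | ret a => simp [bind, algQueries, eval]
  | callALG w η cont ih => simp only [bind, algQueries, eval, ih]; omega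
  | callWSO w cont ih => simp only [bind, algQueries, eval, ih]

lemma wsoQueries_bind (p : OracleProg k Pol α) (f : α → OracleProg k Pol β) :
    (p.bind f).wsoQueries alg Ψ wso
      = p.wsoQueries alg Ψ wso + (f (p.eval alg Ψ wso)).wsoQueries alg Ψ wso := by
  induction p with
  | ret a => simp [bind, wsoQueries, eval]
  | callALG w η cont ih => simp only [bind, wsoQueries, eval, ih]
  | callWSO w cont ih => simp only [bind, wsoQueries, eval, ih]; omega

end OracleProg

open OracleProg Matrix

section Queries

variable {k : ℕ} {Pol : Type u} (alg : (Fin k → ℝ) → ℝ → Pol)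
  (Ψ : Pol → Fin k → ℝ) (wso : (Fin k → ℝ) → Option ((Fin k → ℝ) × ℝ))

lemma ellipsoidSearch_algQueries (s : Fin k → ℝ) (a : ℝ) (n : ℕ)
    (E : (Fin k → ℝ) × Matrix (Fin k) (Fin k) ℝ) :
    (ellipsoidSearch s a n E).algQueries alg Ψ wso = 0 := by
  induction n generalizing E with
  | zero => rfl
  | succ n ih =>
    rw [ellipsoidSearch]
    split_ifs
    · exact ih _
    · exact ih _
    · rw [algQueries]
      split
      · rfl
      · exact ih _

lemma ellipsoidSearch_wsoQueries_le (s : Fin k → ℝ) (a : ℝ) (n : ℕ)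
    (E : (Fin k → ℝ) × Matrix (Fin k) (Fin k) ℝ) :
    (ellipsoidSearch s a n E).wsoQueries alg Ψ wso ≤ n := by
  induction n generalizing E with
  | zero => exact le_rfl
  | succ n ih =>
    rw [ellipsoidSearch]
    split_ifs
    · exact (ih _).trans n.le_succ
    · exact (ih _).trans n.le_succ
    · rw [wsoQueries]
      split
      · simp [wsoQueries]
      · exact Nat.succ_le_succ (ih _)

lemma binarySearch_algQueries (s : Fin k → ℝ) (N J : ℕ) (lo hi : ℝ) (best : Fin k → ℝ) :
    (binarySearch s N J lo hi best).algQueries alg Ψ wso = 0 := by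
  induction J generalizing lo hi best with
  | zero => rfl
  | succ J ih =>
    rw [binarySearch, algQueries_bind, ellipsoidSearch_algQueries, zero_add]
    split <;> exact ih _ _ _

lemma binarySearch_wsoQueries_le (s : Fin k → ℝ) (N J : ℕ) (lo hi : ℝ) (best : Fin k → ℝ) :
    (binarySearch s N J lo hi best).wsoQueries alg Ψ wso ≤ N * J := by
  induction J generalizing lo hi best with
  | zero => exact le_rfl
  | succ J ih =>
    rw [binarySearch, wsoQueries_bind, Nat.mul_succ, add_comm]
    refine add_le_add ?_ (ellipsoidSearch_wsoQueries_le ..)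
    split <;> exact ih _ _ _

lemma roundProg_algQueries (T : ℕ) (ε c : ℝ) (N J : ℕ) (W m p q : Fin k → ℝ) :
    (roundProg T ε c N J W m p q).algQueries alg Ψ wso = 1 := by
  rw [roundProg, algQueries, algQueries_bind, lpMinimize, binarySearch_algQueries]
  rfl

lemma roundProg_wsoQueries_le (T : ℕ) (ε c : ℝ) (N J : ℕ) (W m p q : Fin k → ℝ) :
    (roundProg T ε c N J W m p q).wsoQueries alg Ψ wso ≤ N * J := by
  rw [roundProg, wsoQueries, wsoQueries_bind, lpMinimize]
  exact binarySearch_wsoQueries_le ..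

end Queries

/-! ## Correctness of the linear optimization routine -/

section Correctness

variable {k : ℕ} {Pol : Type u} {alg : (Fin k → ℝ) → ℝ → Pol}
  {Ψ : Pol → Fin k → ℝ} {wso : (Fin k → ℝ) → Option ((Fin k → ℝ) × ℝ)}

lemma ellipsoidSearch_some {s : Fin k → ℝ} {a : ℝ} {n : ℕ}
    {E : (Fin k → ℝ) × Matrix (Fin k) (Fin k) ℝ} {x : Fin k → ℝ}
    (h : (ellipsoidSearch s a n E).eval alg Ψ wso = some x) :
    (∀ j, |x j| ≤ 1) ∧ s ⬝ᵥ x ≤ a ∧ wso x = none := by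
  induction n generalizing E with
  | zero => simp [ellipsoidSearch, eval] at h
  | succ n ih =>
    rw [ellipsoidSearch] at h
    split_ifs at h with h1 h2
    · exact ih h
    · exact ih h
    · rw [eval] at h
      split at h
      next h3 =>
        simp only [eval, Option.some.injEq] at h
        subst h
        exact ⟨by simpa using h1, not_lt.1 h2, h3⟩
      next => exact ih h

lemma boxCut_dotProduct_lt {x y : Fin k → ℝ} (hx : ∃ j, 1 < |x j|) (hy : ∀ j, |y j| ≤ 1) :
    boxCut x ⬝ᵥ y < boxCut x ⬝ᵥ x := by
  obtain ⟨j, hj⟩ := hx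
  refine Finset.sum_lt_sum (fun i _ => ?_) ⟨j, Finset.mem_univ j, ?_⟩
  · have := abs_le.1 (hy i)
    simp only [boxCut]
    split_ifs <;> linarith
  · have := abs_le.1 (hy j)
    simp only [boxCut]
    rcases lt_abs.1 hj with h | h
    · rw [if_pos h]; linarith
    · rw [if_neg (by linarith), if_pos (by linarith)]; linarith

/-- Every cut made without acceptance has `K` strictly on the kept side, so `K` survives all of them
while the determinant shrinks geometrically. -/
lemma ellipsoidSearch_none (hk : 0 < k) {K : Set (Fin k → ℝ)} (hK : K.Nonempty)
    (hbox : ∀ y ∈ K, ∀ j, |y j| ≤ 1) {s : Fin k → ℝ} {a : ℝ} (hs : ∀ y ∈ K, s ⬝ᵥ y ≤ a)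
    (hw : ∀ x h b, wso x = some (h, b) → ∀ y ∈ K, h ⬝ᵥ x < h ⬝ᵥ y) {n : ℕ}
    {E : (Fin k → ℝ) × Matrix (Fin k) (Fin k) ℝ} (hE : E.2.PosDef) (hKE : ∀ y ∈ K, InEllipsoid E y)
    (h : (ellipsoidSearch s a n E).eval alg Ψ wso = none) :
    ∃ E' : (Fin k → ℝ) × Matrix (Fin k) (Fin k) ℝ, E'.2.PosDef ∧ (∀ y ∈ K, InEllipsoid E' y) ∧
      E'.2.det ≤ Real.exp (-(1 / ((k : ℝ) + 1))) ^ n * E.2.det := by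
  induction n generalizing E with
  | zero => exact ⟨E, hE, hKE, by simp⟩
  | succ n ih =>
    have step : ∀ g : Fin k → ℝ, (∀ y ∈ K, g ⬝ᵥ y < g ⬝ᵥ E.1) →
        (ellipsoidSearch s a n (ellipsoidCut E g)).eval alg Ψ wso = none →
        ∃ E' : (Fin k → ℝ) × Matrix (Fin k) (Fin k) ℝ, E'.2.PosDef ∧ (∀ y ∈ K, InEllipsoid E' y) ∧
          E'.2.det ≤ Real.exp (-(1 / ((k : ℝ) + 1))) ^ (n + 1) * E.2.det := by
      intro g hg hn
      -- Strict separation of a nonempty set rules out a zero normal, for which the cut would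
      -- degenerate.
      have hg0 : g ≠ 0 := by
        rintro rfl
        obtain ⟨y, hy⟩ := hK
        simpa using hg y hy
      obtain ⟨E', h1, h2, h3⟩ := ih (posDef_ellipsoidCut hE hk hg0)
        (fun y hy => (hKE y hy).ellipsoidCut hE hk hg0 (hg y hy).le) hn
      refine ⟨E', h1, h2, h3.trans ?_⟩
      rw [pow_succ, mul_assoc]
      exact mul_le_mul_of_nonneg_left (det_ellipsoidCut_le hE hk hg0) (by positivity)
    rw [ellipsoidSearch] at h
    split_ifs at h with h1 h2
    · exact step _ (fun y hy => boxCut_dotProduct_lt h1 (hbox y hy)) h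
    · exact step _ (fun y hy => (hs y hy).trans_lt h2) h
    · rw [eval] at h
      split at h
      next => simp [eval] at h
      next g b h3 =>
        refine step (-g) (fun y hy => ?_) h
        rw [neg_dotProduct, neg_dotProduct, neg_lt_neg_iff]
        exact hw _ _ _ h3 y hy

lemma initialEllipsoid_posDef (hk : 0 < k) : (initialEllipsoid k).2.PosDef :=
  PosDef.one.smul (by exact_mod_cast hk)

lemma inEllipsoid_initialEllipsoid {y : Fin k → ℝ} (hy : ∀ j, |y j| ≤ 1) :
    InEllipsoid (initialEllipsoid k) y := by
  intro g
  simp only [initialEllipsoid, sub_zero, smul_mulVec, one_mulVec, dotProduct_smul, smul_eq_mul]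
  have h1 : (g ⬝ᵥ y) ^ 2 ≤ (∑ i, g i ^ 2) * ∑ i, y i ^ 2 :=
    Finset.sum_mul_sq_le_sq_mul_sq _ _ _
  have h2 : ∑ i, y i ^ 2 ≤ k := by
    calc ∑ i, y i ^ 2 ≤ ∑ _i : Fin k, (1 : ℝ) :=
          Finset.sum_le_sum fun i _ => (sq_le_one_iff_abs_le_one _).2 (hy i)
      _ = k := by simp
  have h3 : g ⬝ᵥ g = ∑ i, g i ^ 2 := Finset.sum_congr rfl fun i _ => (sq _).symm
  rw [h3, mul_comm]
  exact h1.trans (mul_le_mul_of_nonneg_left h2 (Finset.sum_nonneg fun i _ => sq_nonneg _))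

lemma ellipsoidSearch_ne_none_of_cube (hk : 0 < k) {K : Set (Fin k → ℝ)}
    (hbox : ∀ y ∈ K, ∀ j, |y j| ≤ 1) {s : Fin k → ℝ} {a : ℝ} (hs : ∀ y ∈ K, s ⬝ᵥ y ≤ a)
    (hw : ∀ x h b, wso x = some (h, b) → ∀ y ∈ K, h ⬝ᵥ x < h ⬝ᵥ y) {n : ℕ}
    {x : Fin k → ℝ} {ρ : ℝ} (hcube : ∀ u : Fin k → ℝ, (∀ j, |u j| ≤ 1) → x + ρ • u ∈ K)
    (hn : Real.exp (-(1 / ((k : ℝ) + 1))) ^ n * (k : ℝ) ^ k < (ρ ^ 2) ^ k) :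
    (ellipsoidSearch s a n (initialEllipsoid k)).eval alg Ψ wso ≠ none := by
  intro h
  have hK : K.Nonempty := ⟨_, hcube 0 (by simp)⟩
  obtain ⟨E, h1, h2, h3⟩ := ellipsoidSearch_none hk hK hbox hs hw (initialEllipsoid_posDef hk)
    (fun y hy => inEllipsoid_initialEllipsoid (hbox y hy)) h
  have h4 := pow_le_det_of_cube_subset h1 (fun u hu => h2 _ (hcube u hu))
  have h5 : (initialEllipsoid k).2.det = (k : ℝ) ^ k := by simp [initialEllipsoid]
  rw [h5] at h3
  linarith

lemma abs_dotProduct_le_sum_abs {s y : Fin k → ℝ} {b : ℝ} (hy : ∀ j, |y j| ≤ b) :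
    |s ⬝ᵥ y| ≤ b * ∑ j, |s j| := by
  rw [Finset.mul_sum]
  refine (Finset.abs_sum_le_sum_abs _ _).trans (Finset.sum_le_sum fun i _ => ?_)
  rw [abs_mul, mul_comm]
  exact mul_le_mul_of_nonneg_right (hy i) (abs_nonneg _)

/-- The search succeeds as soon as the threshold exceeds the optimal value by the loss incurred
by shrinking the feasible region towards a cube. -/
lemma ellipsoidSearch_ne_none (hk : 0 < k) {P : Set (Fin k → ℝ)} (hP : Convex ℝ P)
    (hbox : ∀ y ∈ P, ∀ j, |y j| ≤ 1) {r : ℝ} (hr : 0 ≤ r)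
    (hcube : ∀ y : Fin k → ℝ, (∀ j, |y j| ≤ r) → y ∈ P)
    (hw : ∀ x h b, wso x = some (h, b) → ∀ y ∈ P, h ⬝ᵥ x < h ⬝ᵥ y) {n : ℕ} {l : ℝ} (hl : 0 ≤ l)
    (hl1 : l ≤ 1) (hn : Real.exp (-(1 / ((k : ℝ) + 1))) ^ n * (k : ℝ) ^ k < ((l * r) ^ 2) ^ k)
    {s y : Fin k → ℝ} (hy : y ∈ P) {a : ℝ} (ha : s ⬝ᵥ y + 2 * l * ∑ j, |s j| ≤ a) :
    (ellipsoidSearch s a n (initialEllipsoid k)).eval alg Ψ wso ≠ none := by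
  have hmem : ∀ u : Fin k → ℝ, (∀ j, |u j| ≤ 1) → r • u ∈ P := fun u hu => hcube _ fun j => by
    rw [Pi.smul_apply, smul_eq_mul, abs_mul, abs_of_nonneg hr]
    exact mul_le_of_le_one_right hr (hu j)
  refine ellipsoidSearch_ne_none_of_cube hk
    -- The cube of half-width `l r` around `(1 - l) y`. Passing from `y` to one of its points moves
    -- the weight `l` between two points of the unit box, hence changes the objective by at most `2
    -- l ‖s‖₁`.
    (K := {z | ∃ u : Fin k → ℝ, (∀ j, |u j| ≤ 1) ∧ z = (1 - l) • y + l • (r • u)})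
    ?_ ?_ ?_ (x := (1 - l) • y) (ρ := l * r) ?_ hn
  · rintro z ⟨u, hu, rfl⟩
    exact hbox _ (hP hy (hmem u hu) (by linarith) hl (by ring))
  · rintro z ⟨u, hu, rfl⟩
    have h1 := (abs_le.1 (abs_dotProduct_le_sum_abs (s := s) (hbox y hy))).1
    have h2 := (abs_le.1 (abs_dotProduct_le_sum_abs (s := s) (hbox _ (hmem u hu)))).2
    rw [dotProduct_add, dotProduct_smul, dotProduct_smul _ s (r • u), smul_eq_mul, smul_eq_mul]
    nlinarith
  · rintro x h b hx z ⟨u, hu, rfl⟩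
    exact hw x h b hx _ (hP hy (hmem u hu) (by linarith) hl (by ring))
  · intro u hu
    exact ⟨u, hu, by rw [smul_smul]⟩

/-- Invariant: `lo` is below all values on `P` up to `σ`, and `hi` is above the value of the
incumbent. A failed search proves the first for the midpoint, a successful one the second, and the
gap halves. The case `x = 0` is separate because the initial incumbent was never submitted to the
oracle. -/
lemma binarySearch_spec {P : Set (Fin k → ℝ)} {s : Fin k → ℝ} {N : ℕ} {σ : ℝ}
    (hsearch : ∀ a, ∀ y ∈ P, s ⬝ᵥ y + σ ≤ a →
      (ellipsoidSearch s a N (initialEllipsoid k)).eval alg Ψ wso ≠ none)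
    {J : ℕ} {lo hi : ℝ} {best : Fin k → ℝ} (hlo : ∀ y ∈ P, lo ≤ s ⬝ᵥ y + σ)
    (hhi : s ⬝ᵥ best ≤ hi) (hb : best = 0 ∨ (∀ j, |best j| ≤ 1) ∧ wso best = none) (hlh : lo ≤ hi) :
    let x := (binarySearch s N J lo hi best).eval alg Ψ wso
    (x = 0 ∨ (∀ j, |x j| ≤ 1) ∧ wso x = none) ∧ s ⬝ᵥ x ≤ hi ∧
      ∀ y ∈ P, s ⬝ᵥ x ≤ s ⬝ᵥ y + σ + (hi - lo) / 2 ^ J := by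
  induction J generalizing lo hi best with
  | zero =>
    refine ⟨hb, hhi, fun y hy => ?_⟩
    have := hlo y hy
    simp only [binarySearch, eval, pow_zero, div_one]
    linarith
  | succ J ih =>
    rw [binarySearch, eval_bind]
    rcases hres : (ellipsoidSearch s ((lo + hi) / 2) N (initialEllipsoid k)).eval alg Ψ wso
      with _ | x
    · have hlo' : ∀ y ∈ P, (lo + hi) / 2 ≤ s ⬝ᵥ y + σ := by
        intro y hy
        by_contra hc
        exact hsearch _ y hy (not_le.1 hc).le hres
      have h := ih hlo' hhi hb (by linarith)
      refine ⟨h.1, h.2.1, fun y hy => (h.2.2 y hy).trans (le_of_eq ?_)⟩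
      rw [pow_succ]; field_simp; ring
    · obtain ⟨h1, h2, h3⟩ := ellipsoidSearch_some hres
      have h := ih hlo h2 (Or.inr ⟨h1, h3⟩) (by linarith)
      refine ⟨h.1, h.2.1.trans (by linarith), fun y hy => (h.2.2 y hy).trans (le_of_eq ?_)⟩
      rw [pow_succ]; field_simp; ring

lemma lpMinimize_spec (hk : 0 < k) {P : Set (Fin k → ℝ)} (hP : Convex ℝ P)
    (hbox : ∀ y ∈ P, ∀ j, |y j| ≤ 1) {r : ℝ} (hr : 0 ≤ r)
    (hcube : ∀ y : Fin k → ℝ, (∀ j, |y j| ≤ r) → y ∈ P)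
    (hw : ∀ x h b, wso x = some (h, b) → ∀ y ∈ P, h ⬝ᵥ x < h ⬝ᵥ y) {N J : ℕ} {l : ℝ} (hl : 0 ≤ l)
    (hl1 : l ≤ 1) (hN : Real.exp (-(1 / ((k : ℝ) + 1))) ^ N * (k : ℝ) ^ k < ((l * r) ^ 2) ^ k)
    (s : Fin k → ℝ) :
    let x := (lpMinimize s N J).eval alg Ψ wso
    (x = 0 ∨ (∀ j, |x j| ≤ 1) ∧ wso x = none) ∧ s ⬝ᵥ x ≤ 0 ∧
      ∀ y ∈ P, s ⬝ᵥ x ≤ s ⬝ᵥ y + 2 * l * (∑ j, |s j|) + (∑ j, |s j|) / 2 ^ J := by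
  have hs : 0 ≤ ∑ j, |s j| := Finset.sum_nonneg fun j _ => abs_nonneg _
  have h := binarySearch_spec (alg := alg) (Ψ := Ψ) (wso := wso) (P := P) (s := s) (N := N)
    (σ := 2 * l * ∑ j, |s j|)
    (fun a y hy ha => ellipsoidSearch_ne_none hk hP hbox hr hcube hw hl hl1 hN hy ha)
    (J := J) (lo := -∑ j, |s j|) (hi := 0) (best := 0)
    (fun y hy => by
      have h1 := (abs_le.1 (abs_dotProduct_le_sum_abs (s := s) (hbox y hy))).1
      have : 0 ≤ 2 * l * ∑ j, |s j| := by positivity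
      linarith)
    (by simp) (Or.inl rfl) (by linarith)
  simpa [lpMinimize] using h

end Correctness

/-! ## Measurability of the linear optimization routine -/

section Measurability

variable {k : ℕ} {Pol : Type u} {alg : (Fin k → ℝ) → ℝ → Pol}
  {Ψ : Pol → Fin k → ℝ} {wso : (Fin k → ℝ) → Option ((Fin k → ℝ) × ℝ)}
  {Ω : Type*} [MeasurableSpace Ω]

lemma measurable_boxCut {x : Ω → Fin k → ℝ} (hx : Measurable x) :
    Measurable fun ω => boxCut (x ω) := by
  unfold boxCut
  refine measurable_pi_lambda _ fun j => ?_
  refine Measurable.ite (measurableSet_lt (by fun_prop) (by fun_prop)) (by fun_prop) ?_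
  exact Measurable.ite (measurableSet_lt (by fun_prop) (by fun_prop)) (by fun_prop) (by fun_prop)

lemma measurable_mulVec {Q : Ω → Matrix (Fin k) (Fin k) ℝ} {g : Ω → Fin k → ℝ}
    (hQ : ∀ i j, Measurable fun ω => Q ω i j) (hg : Measurable g) :
    Measurable fun ω => Q ω *ᵥ g ω := by
  refine measurable_pi_lambda _ fun i => ?_
  have h : ∀ j, Measurable fun ω => Q ω i j * g ω j := fun j =>
    (hQ i j).mul ((measurable_pi_apply j).comp hg)
  exact Finset.measurable_sum Finset.univ fun j _ => h j

lemma measurable_ellipsoidCut {E : Ω → (Fin k → ℝ) × Matrix (Fin k) (Fin k) ℝ} {g : Ω → Fin k → ℝ}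
    (h1 : Measurable fun ω => (E ω).1) (h2 : ∀ i j, Measurable fun ω => (E ω).2 i j)
    (hg : Measurable g) :
    (Measurable fun ω => (ellipsoidCut (E ω) (g ω)).1) ∧
      ∀ i j, Measurable fun ω => (ellipsoidCut (E ω) (g ω)).2 i j := by
  have hb := measurable_mulVec h2 hg
  have hr : Measurable fun ω => g ω ⬝ᵥ (E ω).2 *ᵥ g ω := by fun_prop
  refine ⟨?_, fun i j => ?_⟩
  · simp only [ellipsoidCut]
    exact h1.sub (((hr.sqrt.const_mul _).const_div _).smul hb)
  · have hbi := fun i => (measurable_pi_apply (X := fun _ => ℝ) i).comp hb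
    simp only [ellipsoidCut]
    split_ifs
    · exact (h2 i j).const_mul _
    · exact ((h2 i j).sub (((hr.const_mul _).const_div _).mul ((hbi i).mul (hbi j)))).const_mul _

/-- The oracle answers measurably. -/
structure MeasurableOracle (wso : (Fin k → ℝ) → Option ((Fin k → ℝ) × ℝ)) : Prop where
  accept : MeasurableSet {x | wso x = none}
  cut : ∃ H : (Fin k → ℝ) → Fin k → ℝ, Measurable H ∧ ∀ x h b, wso x = some (h, b) → h = H x

/-- Measurability of an optional result is expressed by the failure event together with the result
under the default `0`. This is what the case distinction in the binary search consumes. -/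
lemma ellipsoidSearch_measurable (hwso : MeasurableOracle wso) (n : ℕ) {s : Ω → Fin k → ℝ}
    {a : Ω → ℝ} {E : Ω → (Fin k → ℝ) × Matrix (Fin k) (Fin k) ℝ} (hs : Measurable s)
    (ha : Measurable a) (h1 : Measurable fun ω => (E ω).1)
    (h2 : ∀ i j, Measurable fun ω => (E ω).2 i j) :
    MeasurableSet {ω | (ellipsoidSearch (s ω) (a ω) n (E ω)).eval alg Ψ wso = none} ∧
      Measurable fun ω => ((ellipsoidSearch (s ω) (a ω) n (E ω)).eval alg Ψ wso).getD 0 := by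
  induction n generalizing E with
  | zero => simp [ellipsoidSearch, eval]
  | succ n ih =>
    obtain ⟨H, hH, hcut⟩ := hwso.cut
    have hbox : MeasurableSet {ω | ∃ j, 1 < |(E ω).1 j|} := by
      simp only [Set.ofPred_exists]
      exact MeasurableSet.iUnion fun j => measurableSet_lt (by fun_prop) (by fun_prop)
    have hobj : MeasurableSet {ω | a ω < s ω ⬝ᵥ (E ω).1} :=
      measurableSet_lt (by fun_prop) (by fun_prop)
    have hacc : MeasurableSet {ω | wso (E ω).1 = none} := h1 hwso.accept
    have hc1 := measurable_ellipsoidCut h1 h2 (measurable_boxCut h1)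
    have hc2 := measurable_ellipsoidCut h1 h2 hs
    have hc3 := measurable_ellipsoidCut h1 h2 ((hH.comp h1).neg)
    obtain ⟨a1, b1⟩ := ih hc1.1 hc1.2
    obtain ⟨a2, b2⟩ := ih hc2.1 hc2.2
    obtain ⟨a3, b3⟩ := ih hc3.1 hc3.2
    -- One iteration as a nested conditional on measurable events, with the oracle's normal replaced
    -- by the total measurable function `H`.
    have key : ∀ ω, (ellipsoidSearch (s ω) (a ω) (n + 1) (E ω)).eval alg Ψ wso =
        if ∃ j, 1 < |(E ω).1 j| then
          (ellipsoidSearch (s ω) (a ω) n (ellipsoidCut (E ω) (boxCut (E ω).1))).eval alg Ψ wso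
        else if a ω < s ω ⬝ᵥ (E ω).1 then
          (ellipsoidSearch (s ω) (a ω) n (ellipsoidCut (E ω) (s ω))).eval alg Ψ wso
        else if wso (E ω).1 = none then some (E ω).1
        else (ellipsoidSearch (s ω) (a ω) n (ellipsoidCut (E ω) (-H (E ω).1))).eval alg Ψ wso := by
      intro ω
      rw [ellipsoidSearch]
      split_ifs with i1 i2 i3
      · rfl
      · rfl
      · rw [eval, i3]; rfl
      · rw [eval]
        split
        next h => exact absurd h i3
        next h b h' => rw [hcut _ _ _ h']
    simp only [key]
    constructor
    · have e : {ω | (if ∃ j, 1 < |(E ω).1 j| then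
          (ellipsoidSearch (s ω) (a ω) n (ellipsoidCut (E ω) (boxCut (E ω).1))).eval alg Ψ wso
        else if a ω < s ω ⬝ᵥ (E ω).1 then
          (ellipsoidSearch (s ω) (a ω) n (ellipsoidCut (E ω) (s ω))).eval alg Ψ wso
        else if wso (E ω).1 = none then some (E ω).1
        else (ellipsoidSearch (s ω) (a ω) n (ellipsoidCut (E ω) (-H (E ω).1))).eval alg Ψ wso)
          = none}
        = Set.ite {ω | ∃ j, 1 < |(E ω).1 j|} {ω | (ellipsoidSearch (s ω) (a ω) n
            (ellipsoidCut (E ω) (boxCut (E ω).1))).eval alg Ψ wso = none}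
          (Set.ite {ω | a ω < s ω ⬝ᵥ (E ω).1} {ω | (ellipsoidSearch (s ω) (a ω) n
            (ellipsoidCut (E ω) (s ω))).eval alg Ψ wso = none}
          ({ω | (ellipsoidSearch (s ω) (a ω) n (ellipsoidCut (E ω) (-H (E ω).1))).eval alg Ψ wso
            = none} \ {ω | wso (E ω).1 = none})) := by
        ext ω
        simp only [Set.mem_ofPred_eq, Set.ite, Set.mem_union, Set.mem_inter_iff, Set.mem_sdiff]
        by_cases i1 : ∃ j, 1 < |(E ω).1 j| <;> by_cases i2 : a ω < s ω ⬝ᵥ (E ω).1 <;>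
          by_cases i3 : wso (E ω).1 = none <;>
          simp only [i1, i2, i3, if_true, if_false, and_true, and_false, not_true, not_false_iff,
            or_false, false_or, reduceCtorEq]
      rw [e]
      exact hbox.ite a1 (hobj.ite a2 (a3.diff hacc))
    · simp only [apply_ite (fun o : Option (Fin k → ℝ) => o.getD 0)]
      exact Measurable.ite hbox b1 (Measurable.ite hobj b2 (Measurable.ite hacc h1 b3))

lemma binarySearch_measurable (hwso : MeasurableOracle wso) (N J : ℕ) {s best : Ω → Fin k → ℝ}
    {lo hi : Ω → ℝ} (hs : Measurable s) (hlo : Measurable lo) (hhi : Measurable hi)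
    (hb : Measurable best) :
    Measurable fun ω => (binarySearch (s ω) N J (lo ω) (hi ω) (best ω)).eval alg Ψ wso := by
  induction J generalizing lo hi best with
  | zero => exact hb
  | succ J ih =>
    have hmid : Measurable fun ω => (lo ω + hi ω) / 2 := by fun_prop
    obtain ⟨h1, h2⟩ := ellipsoidSearch_measurable (alg := alg) (Ψ := Ψ) hwso N
      (E := fun _ => initialEllipsoid k) hs hmid measurable_const (fun _ _ => measurable_const)
    have key : ∀ ω, (binarySearch (s ω) N (J + 1) (lo ω) (hi ω) (best ω)).eval alg Ψ wso =
        if (ellipsoidSearch (s ω) ((lo ω + hi ω) / 2) N (initialEllipsoid k)).eval alg Ψ wso = none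
        then (binarySearch (s ω) N J ((lo ω + hi ω) / 2) (hi ω) (best ω)).eval alg Ψ wso
        else (binarySearch (s ω) N J (lo ω) ((lo ω + hi ω) / 2)
          (((ellipsoidSearch (s ω) ((lo ω + hi ω) / 2) N (initialEllipsoid k)).eval alg Ψ wso).getD
            0)).eval alg Ψ wso := by
      intro ω
      rw [binarySearch, eval_bind]
      rcases (ellipsoidSearch (s ω) ((lo ω + hi ω) / 2) N (initialEllipsoid k)).eval alg Ψ wso
        with _ | x <;> simp
    simp only [key]
    exact Measurable.ite h1 (ih hmid hhi hb) (ih hlo hmid h2)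

lemma lpMinimize_measurable (hwso : MeasurableOracle wso) (N J : ℕ) :
    Measurable fun s => (lpMinimize s N J).eval alg Ψ wso :=
  binarySearch_measurable hwso N J (s := fun s => s) (best := fun _ => 0) measurable_id
    (by fun_prop) measurable_const measurable_const

end Measurability

end MaxminFPL

namespace MaxminFPL

open Matrix

/-! ## Uniform perturbations -/

section CubeLaw

variable {k : ℕ} {L : ℝ}

/-- The uniform distribution on `[0, L]^k`. -/
noncomputable def cubeLaw (k : ℕ) (L : ℝ) : Measure (Fin k → ℝ) :=
  ProbabilityTheory.cond volume (Set.Icc (0 : Fin k → ℝ) (fun _ => L))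

lemma volume_cube (L : ℝ) (v : Fin k → ℝ) :
    volume (Set.Icc v (v + fun _ => L)) = ENNReal.ofReal L ^ k := by
  rw [Real.volume_Icc_pi]; simp

lemma volume_cube_zero (L : ℝ) :
    volume (Set.Icc (0 : Fin k → ℝ) (fun _ => L)) = ENNReal.ofReal L ^ k := by
  have := volume_cube L (0 : Fin k → ℝ)
  rwa [zero_add] at this

lemma isProbabilityMeasure_cubeLaw (k : ℕ) (hL : 0 < L) : IsProbabilityMeasure (cubeLaw k L) := by
  refine ProbabilityTheory.cond_isProbabilityMeasure_of_finite ?_ ?_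
  · rw [volume_cube_zero]
    exact pow_ne_zero _ (by simpa using hL)
  · rw [volume_cube_zero]
    exact ENNReal.pow_ne_top ENNReal.ofReal_ne_top

lemma ae_mem_cube (k : ℕ) (L : ℝ) :
    ∀ᵐ q ∂cubeLaw k L, q ∈ Set.Icc (0 : Fin k → ℝ) (fun _ => L) :=
  ProbabilityTheory.ae_cond_mem measurableSet_Icc

lemma integral_cubeLaw (hL : 0 < L) (f : (Fin k → ℝ) → ℝ) :
    ∫ q, f q ∂cubeLaw k L = (L ^ k)⁻¹ * ∫ q in Set.Icc (0 : Fin k → ℝ) (fun _ => L), f q := by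
  rw [cubeLaw, ProbabilityTheory.cond, integral_smul_measure, volume_cube_zero,
    ENNReal.toReal_inv, ENNReal.toReal_pow, ENNReal.toReal_ofReal hL.le, smul_eq_mul]

lemma one_sub_sum_le_prod {ι : Type*} (s : Finset ι) (a : ι → ℝ) (h0 : ∀ i, 0 ≤ a i)
    (h1 : ∀ i, a i ≤ 1) : 1 - ∑ i ∈ s, a i ≤ ∏ i ∈ s, (1 - a i) := by
  classical
  induction s using Finset.induction_on with
  | empty => simp
  | insert i s hi ih =>
    rw [Finset.sum_insert hi, Finset.prod_insert hi]
    have h2 : ∏ j ∈ s, (1 - a j) ≤ 1 :=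
      Finset.prod_le_one (fun j _ => by linarith [h1 j]) fun j _ => by linarith [h0 j]
    nlinarith [h0 i]

lemma volume_cube_sdiff_le (hL : 0 < L) (v : Fin k → ℝ) :
    volume.real (Set.Icc (0 : Fin k → ℝ) (fun _ => L) \ Set.Icc v (v + fun _ => L))
      ≤ L ^ k * ((∑ j, |v j|) / L) := by
  have hA : volume.real (Set.Icc (0 : Fin k → ℝ) (fun _ => L)) = L ^ k := by
    rw [measureReal_def, volume_cube_zero, ENNReal.toReal_pow, ENNReal.toReal_ofReal hL.le]
  have hfin : volume (Set.Icc (0 : Fin k → ℝ) (fun _ => L)) ≠ ⊤ := by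
    rw [volume_cube_zero]; exact ENNReal.pow_ne_top ENNReal.ofReal_ne_top
  have hsum := measureReal_inter_add_sdiff (μ := volume)
    (s := Set.Icc (0 : Fin k → ℝ) (fun _ => L)) (t := Set.Icc v (v + fun _ => L))
    measurableSet_Icc hfin
  rw [hA] at hsum
  have hLk : 0 < L ^ k := by positivity
  -- If no coordinate of the shift exceeds `L`, the overlap is a box of volume `∏ (L - |v j|)`,
  -- bounded below by Bernoulli's inequality; otherwise the right-hand side already exceeds the
  -- volume of the cube.
  by_cases hv : ∀ j, |v j| ≤ L
  · have h1 : volume.real (Set.Icc (0 : Fin k → ℝ) (fun _ => L) ∩ Set.Icc v (v + fun _ => L))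
        = ∏ j, (L - |v j|) := by
      rw [Set.Icc_inter_Icc, measureReal_def, Real.volume_Icc_pi_toReal]
      · refine Finset.prod_congr rfl fun j _ => ?_
        simp only [Pi.inf_apply, Pi.sup_apply, Pi.add_apply, Pi.zero_apply]
        rcases le_total 0 (v j) with h | h
        · rw [abs_of_nonneg h, sup_of_le_right h, inf_of_le_left (by linarith)]
        · rw [abs_of_nonpos h, sup_of_le_left h, inf_of_le_right (by linarith)]; ring
      · intro j
        have := abs_le.1 (hv j)
        simp only [Pi.inf_apply, Pi.sup_apply, Pi.add_apply, Pi.zero_apply]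
        apply sup_le <;> apply le_inf <;> linarith
    have h2 : ∏ j, (L - |v j|) = L ^ k * ∏ j, (1 - |v j| / L) := by
      have : ∀ j, L - |v j| = L * (1 - |v j| / L) := fun j => by field_simp
      simp only [this]
      rw [Finset.prod_mul_distrib]; simp
    have h3 := one_sub_sum_le_prod Finset.univ (fun j => |v j| / L) (fun j => by positivity)
      (fun j => (div_le_one hL).2 (hv j))
    rw [← Finset.sum_div] at h3
    rw [h1, h2] at hsum
    nlinarith
  · push Not at hv
    obtain ⟨j, hj⟩ := hv
    have h1 : 1 ≤ (∑ j, |v j|) / L := by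
      rw [le_div_iff₀ hL, one_mul]
      exact hj.le.trans (Finset.single_le_sum (f := fun j => |v j|) (fun j _ => abs_nonneg _)
        (Finset.mem_univ j))
    have h2 : 0 ≤ volume.real
        (Set.Icc (0 : Fin k → ℝ) (fun _ => L) ∩ Set.Icc v (v + fun _ => L)) := measureReal_nonneg
    nlinarith

/-- Translating the argument by `v` changes the mean of a function with values in `[0, M]` by at
most `M ‖v‖₁ / L`. -/
lemma integral_cubeLaw_sub_translate_le (hL : 0 < L) {F : (Fin k → ℝ) → ℝ} (hF : Measurable F)
    {M : ℝ} (h0 : ∀ x, 0 ≤ F x) (hM : ∀ x, F x ≤ M) (v : Fin k → ℝ) :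
    ∫ q, F q ∂cubeLaw k L - ∫ q, F (v + q) ∂cubeLaw k L ≤ M * ((∑ j, |v j|) / L) := by
  rw [integral_cubeLaw hL, integral_cubeLaw hL]
  set A := Set.Icc (0 : Fin k → ℝ) (fun _ => L) with hA
  set A' := Set.Icc v (v + fun _ => L) with hA'
  have hpre : (fun q => v + q) ⁻¹' A' = A := by
    rw [hA', hA, Set.preimage_const_add_Icc]; simp
  have h1 : ∫ q in A, F (v + q) = ∫ q in A', F q := by
    rw [← hpre]
    exact (measurePreserving_add_left volume v).setIntegral_preimage_emb
      (MeasurableEquiv.addLeft v).measurableEmbedding F A'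
  rw [h1]
  have hfinA : volume A ≠ ⊤ := by
    rw [hA, volume_cube_zero]; exact ENNReal.pow_ne_top ENNReal.ofReal_ne_top
  have hfinA' : volume A' ≠ ⊤ := by
    rw [hA', volume_cube]; exact ENNReal.pow_ne_top ENNReal.ofReal_ne_top
  have hb : ∀ x, ‖F x‖ ≤ M := fun x => by rw [Real.norm_of_nonneg (h0 x)]; exact hM x
  have hint : ∀ B : Set (Fin k → ℝ), volume B ≠ ⊤ → IntegrableOn F B := fun B hB =>
    Measure.integrableOn_of_bounded hB hF.aestronglyMeasurable (Filter.Eventually.of_forall hb)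
  have h2 := integral_inter_add_sdiff (μ := volume) (f := F) (s := A) (t := A')
    measurableSet_Icc (hint A hfinA)
  have h3 : ∫ q in A ∩ A', F q ≤ ∫ q in A', F q :=
    setIntegral_mono_set (hint A' hfinA') (Filter.Eventually.of_forall h0)
      (LE.le.eventuallyLE Set.inter_subset_right)
  have h4 : ∫ q in A \ A', F q ≤ M * volume.real (A \ A') := by
    have := norm_setIntegral_le_of_norm_le_const (μ := volume) (s := A \ A') (f := F) (C := M)
      (lt_of_le_of_lt (measure_mono Set.sdiff_subset) hfinA.lt_top) (fun x _ => hb x)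
    exact (le_abs_self _).trans this
  have hM0 : 0 ≤ M := (h0 0).trans (hM 0)
  have h5 := mul_le_mul_of_nonneg_left (volume_cube_sdiff_le hL v) hM0
  have hLk : 0 < L ^ k := by positivity
  rw [← mul_sub, inv_mul_le_iff₀ hLk]
  calc _ ≤ M * volume.real (A \ A') := by linarith
    _ ≤ _ := h5
    _ = _ := by ring

lemma integrable_of_abs_le {X : Type*} [MeasurableSpace X] {μ : Measure X} [IsFiniteMeasure μ]
    {f : X → ℝ} (hf : Measurable f) {B : ℝ} (hB : ∀ x, |f x| ≤ B) : Integrable f μ :=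
  Integrable.of_bound hf.aestronglyMeasurable B (Filter.Eventually.of_forall hB)

/-- Adding the constant `B` moves the range of `f` into `[0, 2B]`, where the one-sided translation
bound applies. -/
lemma integral_cubeLaw_stable (hL : 0 < L) {f : (Fin k → ℝ) → ℝ} (hf : Measurable f)
    {B : ℝ} (hB : ∀ x, |f x| ≤ B) (x v : Fin k → ℝ) :
    ∫ q, f (x + q) ∂cubeLaw k L - ∫ q, f (x + v + q) ∂cubeLaw k L
      ≤ 2 * B * ((∑ j, |v j|) / L) := by
  have := isProbabilityMeasure_cubeLaw k hL
  have hm : Measurable fun q => f (x + q) + B := by fun_prop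
  have h := integral_cubeLaw_sub_translate_le hL hm (M := 2 * B)
    (fun q => by linarith [(abs_le.1 (hB (x + q))).1])
    (fun q => by linarith [(abs_le.1 (hB (x + q))).2]) v
  rw [integral_add (integrable_of_abs_le (by fun_prop) fun q => hB _) (integrable_const _),
    integral_add (integrable_of_abs_le (by fun_prop) fun q => hB _) (integrable_const _)] at h
  simp only [add_assoc]
  linarith

lemma integral_cubeLaw_sum (hL : 0 < L) : ∫ q, ∑ j, q j ∂cubeLaw k L = k * L / 2 := by
  have := isProbabilityMeasure_cubeLaw k hL
  have hint : Integrable (fun q : Fin k → ℝ => ∑ j, q j) (cubeLaw k L) := by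
    refine Integrable.of_bound (by fun_prop) (k * L) ?_
    filter_upwards [ae_mem_cube k L] with q hq
    rw [Real.norm_of_nonneg (Finset.sum_nonneg fun j _ => hq.1 j)]
    calc ∑ j, q j ≤ ∑ _j : Fin k, L := Finset.sum_le_sum fun j _ => hq.2 j
      _ = k * L := by simp
  have hpre : (fun q : Fin k → ℝ => (fun _ => L) - q) ⁻¹' Set.Icc 0 (fun _ => L)
      = Set.Icc 0 (fun _ => L) := by
    rw [Set.preimage_const_sub_Icc]; simp
  -- The cube is invariant under `q ↦ L - q`, so the mean equals its own reflection and no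
  -- coordinatewise integration is needed.
  have hrefl : ∫ q, ∑ j, q j ∂cubeLaw k L = ∫ q, ∑ j, (L - q j) ∂cubeLaw k L := by
    rw [integral_cubeLaw hL, integral_cubeLaw hL]
    congr 1
    have := (Measure.measurePreserving_sub_left (volume : Measure (Fin k → ℝ))
      (fun _ => L)).setIntegral_preimage_emb
      (MeasurableEquiv.subLeft (fun _ : Fin k => L)).measurableEmbedding
      (fun q => ∑ j, q j) (Set.Icc 0 (fun _ => L))
    rw [hpre] at this
    rw [← this]
    simp
  have h2 : ∫ q, ∑ j, (L - q j) ∂cubeLaw k L = k * L - ∫ q, ∑ j, q j ∂cubeLaw k L := by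
    simp only [Finset.sum_sub_distrib]
    rw [integral_sub (integrable_const _) hint]
    simp
  linarith

end CubeLaw

/-! ## Regret of follow the perturbed leader -/

section Regret

variable {k T : ℕ} {L : ℝ}

/-- Be the leader: playing the minimizer of the costs up to and including the current round costs
no more than the final minimizer, up to the cost of the perturbation. -/
lemma be_the_leader {h : (Fin k → ℝ) → Fin k → ℝ} {X v : ℕ → Fin k → ℝ} (hX0 : X 0 = 0)
    (hX : ∀ t < T, X (t + 1) = X t + v t) {e : ℝ} {q : Fin k → ℝ}
    (hopt : ∀ t ≤ T, ∀ x, (X t + q) ⬝ᵥ h (X t + q) ≤ (X t + q) ⬝ᵥ h x + e) (n : ℕ) (hn : n ≤ T) :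
    ∑ t ∈ Finset.range n, v t ⬝ᵥ h (X (t + 1) + q)
      ≤ (X n + q) ⬝ᵥ h (X n + q) - q ⬝ᵥ h q + n * e := by
  induction n with
  | zero => simp [hX0]
  | succ n ih =>
    have h1 := ih (by omega)
    have h2 := hopt n (by omega) (X (n + 1) + q)
    rw [Finset.sum_range_succ]
    have h3 : (X (n + 1) + q) ⬝ᵥ h (X (n + 1) + q)
        = (X n + q) ⬝ᵥ h (X (n + 1) + q) + v n ⬝ᵥ h (X (n + 1) + q) := by
      rw [hX n (by omega), ← add_dotProduct]; congr 1; abel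
    rw [h3]
    push_cast
    linarith

lemma sum_range_eq_of_step {X v : ℕ → Fin k → ℝ} (hX0 : X 0 = 0)
    (hX : ∀ t < T, X (t + 1) = X t + v t) (n : ℕ) (hn : n ≤ T) :
    X n = ∑ t ∈ Finset.range n, v t := by
  induction n with
  | zero => simp [hX0]
  | succ n ih => rw [Finset.sum_range_succ, ← ih (by omega), hX n (by omega)]

/-- Each summand on the left depends on the law of one perturbation only, so a single `q` may serve
all rounds. For it the leader that already knows the current cost has regret at most `b q` plus `T +
1` optimization errors. Not knowing the cost `v t` amounts to translating the uniform cube by `v t`,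
which costs at most `2 B V / L` per round. -/
lemma fpl_regret (hL : 0 < L) {h : (Fin k → ℝ) → Fin k → ℝ} (hm : Measurable h)
    {K : Set (Fin k → ℝ)} (hK : ∀ x, h x ∈ K) {X v : ℕ → Fin k → ℝ} (hX0 : X 0 = 0)
    (hX : ∀ t < T, X (t + 1) = X t + v t) {B V e R : ℝ} (hB : ∀ t < T, ∀ x, |v t ⬝ᵥ h x| ≤ B)
    (hB0 : 0 ≤ B) (hV : ∀ t < T, ∑ j, |v t j| ≤ V)
    (hopt : ∀ t ≤ T, ∀ q ∈ Set.Icc (0 : Fin k → ℝ) (fun _ => L), ∀ w ∈ K,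
      (X t + q) ⬝ᵥ h (X t + q) ≤ (X t + q) ⬝ᵥ w + e)
    {w : Fin k → ℝ} (hw : w ∈ K) {b : (Fin k → ℝ) → ℝ} (hb : Integrable b (cubeLaw k L))
    (hbw : ∀ q ∈ Set.Icc (0 : Fin k → ℝ) (fun _ => L), q ⬝ᵥ w - q ⬝ᵥ h q ≤ b q)
    (hR : ∫ q, b q ∂cubeLaw k L ≤ R) :
    ∑ t ∈ Finset.range T, ∫ q, v t ⬝ᵥ h (X t + q) ∂cubeLaw k L
      ≤ ∑ t ∈ Finset.range T, v t ⬝ᵥ w + T * (2 * B * (V / L)) + R + (T + 1) * e := by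
  have := isProbabilityMeasure_cubeLaw k hL
  have hvm : ∀ t, Measurable fun x => v t ⬝ᵥ h x := fun t => by fun_prop
  have hint : ∀ t < T, ∀ y, Integrable (fun q => v t ⬝ᵥ h (y + q)) (cubeLaw k L) :=
    fun t ht y => integrable_of_abs_le ((hvm t).comp (by fun_prop)) fun q => hB t ht _
  have hstab : ∀ t < T, ∫ q, v t ⬝ᵥ h (X t + q) ∂cubeLaw k L
      ≤ ∫ q, v t ⬝ᵥ h (X (t + 1) + q) ∂cubeLaw k L + 2 * B * (V / L) := by
    intro t ht
    have h1 := integral_cubeLaw_stable hL (hvm t) (hB t ht) (X t) (v t)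
    rw [← hX t ht] at h1
    have h2 : 2 * B * ((∑ j, |v t j|) / L) ≤ 2 * B * (V / L) := by
      have := hV t ht
      gcongr
    linarith
  have hlead : ∑ t ∈ Finset.range T, ∫ q, v t ⬝ᵥ h (X (t + 1) + q) ∂cubeLaw k L
      ≤ ∑ t ∈ Finset.range T, v t ⬝ᵥ w + R + (T + 1) * e := by
    rw [← integral_finsetSum _ fun t ht => hint t (Finset.mem_range.1 ht) _]
    have hle : ∫ q, ∑ t ∈ Finset.range T, v t ⬝ᵥ h (X (t + 1) + q) ∂cubeLaw k L
        ≤ ∫ q, (b q + (∑ t ∈ Finset.range T, v t ⬝ᵥ w + (T + 1) * e)) ∂cubeLaw k L := by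
      refine integral_mono_ae (integrable_finsetSum _ fun t ht => hint t (Finset.mem_range.1 ht) _)
        (hb.add (integrable_const _)) ?_
      filter_upwards [ae_mem_cube k L] with q hq
      have h1 := be_the_leader hX0 hX (fun t ht x => hopt t ht q hq _ (hK x)) T le_rfl
      have h2 := hopt T le_rfl q hq w hw
      have h3 := hbw q hq
      have h4 : X T ⬝ᵥ w = ∑ t ∈ Finset.range T, v t ⬝ᵥ w := by
        rw [sum_range_eq_of_step hX0 hX T le_rfl, sum_dotProduct]
      rw [add_dotProduct _ _ w, h4] at h2
      linarith
    rw [integral_add hb (integrable_const _)] at hle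
    simp only [integral_const, probReal_univ, one_smul] at hle
    linarith
  calc _ ≤ ∑ t ∈ Finset.range T,
        (∫ q, v t ⬝ᵥ h (X (t + 1) + q) ∂cubeLaw k L + 2 * B * (V / L)) :=
        Finset.sum_le_sum fun t ht => hstab t (Finset.mem_range.1 ht)
    _ = ∑ t ∈ Finset.range T, ∫ q, v t ⬝ᵥ h (X (t + 1) + q) ∂cubeLaw k L
        + T * (2 * B * (V / L)) := by
        rw [Finset.sum_add_distrib]; simp
    _ ≤ _ := by linarith

end Regret

end MaxminFPL

namespace MaxminFPL

/-! ## Concentration for adapted functions of independent variables -/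

section Concentration

open ProbabilityTheory

variable {X : Type*} [MeasurableSpace X] {ν : Measure X} [IsProbabilityMeasure ν] {T : ℕ}

/-- Fubini for one coordinate: resampling it does not change the mean. It plays the role of
conditioning on the other coordinates. -/
lemma lintegral_pi_update {f : (Fin T → X) → ENNReal} (hf : Measurable f) (i : Fin T) :
    ∫⁻ ω, f ω ∂Measure.pi (fun _ => ν)
      = ∫⁻ ω, ∫⁻ x, f (Function.update ω i x) ∂ν ∂Measure.pi (fun _ => ν) := by
  have hg : Measurable fun ω => ∫⁻ x, f (Function.update ω i x) ∂ν := by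
    have := hf.lmarginal (fun _ : Fin T => ν) (s := {i})
    rwa [show (∫⋯∫⁻_{i}, f ∂fun _ => ν) = fun ω => ∫⁻ x, f (Function.update ω i x) ∂ν from
      lmarginal_singleton ..] at this
  refine lintegral_eq_of_lmarginal_eq {i} hf hg (funext fun ω => ?_)
  rw [lmarginal_singleton, lmarginal_singleton]
  simp

/-- **Azuma–Hoeffding**, exponential moment form: `D n` depends on the first `n + 1` coordinates,
is bounded by `B`, and has mean zero in the last one of these. -/
lemma lintegral_exp_sum_le {D : ℕ → (Fin T → X) → ℝ} {B : ℝ}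
    (hm : ∀ n < T, Measurable (D n)) (hB : ∀ n < T, ∀ ω, |D n ω| ≤ B)
    (hadapt : ∀ n < T, ∀ (i : Fin T) ω x, n < i → D n (Function.update ω i x) = D n ω)
    (hmean : ∀ n (hn : n < T) ω, ∫ x, D n (Function.update ω ⟨n, hn⟩ x) ∂ν = 0) (s : ℝ)
    (n : ℕ) (hn : n ≤ T) :
    ∫⁻ ω, ENNReal.ofReal (Real.exp (s * ∑ t ∈ Finset.range n, D t ω)) ∂Measure.pi (fun _ => ν)
      ≤ ENNReal.ofReal (Real.exp (B ^ 2 * s ^ 2 / 2)) ^ n := by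
  induction n with
  | zero => simp
  | succ n ih =>
    have hn' : n < T := hn
    have hsum : Measurable fun ω => ∑ t ∈ Finset.range n, D t ω :=
      Finset.measurable_sum _ fun t ht => hm t ((Finset.mem_range.1 ht).trans hn')
    have hsum' : Measurable fun ω => ∑ t ∈ Finset.range (n + 1), D t ω :=
      Finset.measurable_sum _ fun t ht => hm t (by have := Finset.mem_range.1 ht; omega)
    rw [lintegral_pi_update (by fun_prop) ⟨n, hn'⟩, pow_succ]
    have hinner : ∀ ω, ∫⁻ x, ENNReal.ofReal (Real.exp (s * ∑ t ∈ Finset.range (n + 1),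
          D t (Function.update ω ⟨n, hn'⟩ x))) ∂ν
        ≤ ENNReal.ofReal (Real.exp (s * ∑ t ∈ Finset.range n, D t ω))
          * ENNReal.ofReal (Real.exp (B ^ 2 * s ^ 2 / 2)) := by
      intro ω
      have hDm : Measurable fun x => D n (Function.update ω ⟨n, hn'⟩ x) :=
        (hm n hn').comp (measurable_update ω)
      have e : ∀ x, ENNReal.ofReal (Real.exp (s * ∑ t ∈ Finset.range (n + 1),
          D t (Function.update ω ⟨n, hn'⟩ x)))
          = ENNReal.ofReal (Real.exp (s * ∑ t ∈ Finset.range n, D t ω))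
            * ENNReal.ofReal (Real.exp (s * D n (Function.update ω ⟨n, hn'⟩ x))) := by
        intro x
        rw [Finset.sum_range_succ, mul_add, Real.exp_add,
          ENNReal.ofReal_mul (Real.exp_pos _).le]
        congr 4
        exact Finset.sum_congr rfl fun t ht =>
          hadapt t ((Finset.mem_range.1 ht).trans hn') ⟨n, hn'⟩ ω x (Finset.mem_range.1 ht)
      simp only [e]
      rw [lintegral_const_mul _ (by fun_prop)]
      gcongr
      -- Hoeffding's lemma on `[-B, B]`; half the length of the interval, squared, gives the
      -- variance proxy `B²`.
      have hsub := hasSubgaussianMGF_of_mem_Icc_of_integral_eq_zero (μ := ν) (a := -B) (b := B)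
        hDm.aemeasurable (Filter.Eventually.of_forall fun x => abs_le.1 (hB n hn' _))
        (hmean n hn' ω)
      rw [← ofReal_integral_eq_lintegral_ofReal (hsub.integrable_exp_mul s)
        (Filter.Eventually.of_forall fun x => (Real.exp_pos _).le)]
      refine ENNReal.ofReal_le_ofReal ((hsub.mgf_le s).trans (le_of_eq ?_))
      congr 1
      push_cast
      rw [show B - -B = 2 * B by ring, Real.norm_eq_abs, div_pow, sq_abs]
      ring
    refine (lintegral_mono hinner).trans ?_
    rw [lintegral_mul_const _ (by fun_prop)]
    gcongr
    exact ih hn'.le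

lemma measure_sum_gt_le {D : ℕ → (Fin T → X) → ℝ} {B : ℝ} (hB0 : 0 < B) (hT : 0 < T)
    (hm : ∀ n < T, Measurable (D n)) (hB : ∀ n < T, ∀ ω, |D n ω| ≤ B)
    (hadapt : ∀ n < T, ∀ (i : Fin T) ω x, n < i → D n (Function.update ω i x) = D n ω)
    (hmean : ∀ n (hn : n < T) ω, ∫ x, D n (Function.update ω ⟨n, hn⟩ x) ∂ν = 0) {l : ℝ}
    (hl : 0 ≤ l) :
    Measure.pi (fun _ => ν) {ω | l < ∑ t ∈ Finset.range T, D t ω}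
      ≤ ENNReal.ofReal (Real.exp (-(l ^ 2 / (2 * B ^ 2 * T)))) := by
  have hT' : (0 : ℝ) < T := by exact_mod_cast hT
  -- The Chernoff exponent `B² s² T / 2 - s l` is minimal at this `s`.
  set s := l / (B ^ 2 * T) with hs
  have hs0 : 0 ≤ s := by positivity
  have hsum : Measurable fun ω => ∑ t ∈ Finset.range T, D t ω :=
    Finset.measurable_sum _ fun t ht => hm t (Finset.mem_range.1 ht)
  have h1 := lintegral_exp_sum_le hm hB hadapt hmean s T le_rfl
  have h2 := mul_meas_ge_le_lintegral (μ := Measure.pi fun _ : Fin T => ν)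
    (f := fun ω => ENNReal.ofReal (Real.exp (s * ∑ t ∈ Finset.range T, D t ω))) (by fun_prop)
    (ENNReal.ofReal (Real.exp (s * l)))
  have h3 : {ω : Fin T → X | l < ∑ t ∈ Finset.range T, D t ω} ⊆
      {ω | ENNReal.ofReal (Real.exp (s * l))
        ≤ ENNReal.ofReal (Real.exp (s * ∑ t ∈ Finset.range T, D t ω))} := by
    intro ω hω
    refine ENNReal.ofReal_le_ofReal (Real.exp_le_exp.2 ?_)
    exact mul_le_mul_of_nonneg_left (le_of_lt hω) hs0
  have h4 : Measure.pi (fun _ => ν) {ω : Fin T → X | l < ∑ t ∈ Finset.range T, D t ω}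
      = ENNReal.ofReal (Real.exp (-(s * l))) * (ENNReal.ofReal (Real.exp (s * l)) *
        Measure.pi (fun _ => ν) {ω : Fin T → X | l < ∑ t ∈ Finset.range T, D t ω}) := by
    rw [← mul_assoc, ← ENNReal.ofReal_mul (Real.exp_pos _).le, ← Real.exp_add]
    simp
  rw [h4]
  calc _ ≤ ENNReal.ofReal (Real.exp (-(s * l)))
        * ENNReal.ofReal (Real.exp (B ^ 2 * s ^ 2 / 2)) ^ T := by
        gcongr
        exact (mul_le_mul_right (measure_mono h3) _).trans (h2.trans h1)
    _ = _ := by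
        rw [← ENNReal.ofReal_pow (Real.exp_pos _).le, ← Real.exp_nat_mul,
          ← ENNReal.ofReal_mul (Real.exp_pos _).le, ← Real.exp_add]
        congr 2
        rw [hs]
        field_simp
        ring

/-- A function of two independent variables, averaged over each of them in turn: the difference
has mean zero. -/
lemma integral_sub_averages_eq_zero {Y : Type*} [MeasurableSpace Y] {ρ : Measure Y}
    [IsProbabilityMeasure ρ] {G : X × Y → ℝ} (hG : Integrable G (ν.prod ρ)) :
    ∫ z, (∫ y, G (z.1, y) ∂ρ - ∫ x, G (x, z.2) ∂ν) ∂ν.prod ρ = 0 := by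
  have h1 : Integrable (fun z : X × Y => ∫ y, G (z.1, y) ∂ρ) (ν.prod ρ) :=
    hG.integral_prod_left.comp_fst ρ
  have h2 : Integrable (fun z : X × Y => ∫ x, G (x, z.2) ∂ν) (ν.prod ρ) :=
    hG.integral_prod_right.comp_snd ν
  rw [integral_sub h1 h2, integral_prod _ h1, integral_prod_symm _ h2]
  simp only [integral_const, probReal_univ, one_smul]
  rw [← integral_prod _ hG, ← integral_prod_symm _ hG, sub_self]

end Concentration

end MaxminFPL

namespace MaxminFPL

open Matrix

/-! ## The repeated game -/

section Game

variable {k T : ℕ}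

/-- The sums of the plays of both players before round `t`: the weight player answers to the sum
of the feature vectors by `h`, and the feature player to the sum of the weights by `g`. -/
def gameState (g h : (Fin k → ℝ) → Fin k → ℝ) (p q : Fin T → Fin k → ℝ) :
    ℕ → (Fin k → ℝ) × (Fin k → ℝ)
  | 0 => (0, 0)
  | t + 1 =>
    let s := gameState g h p q t
    if ht : t < T then (s.1 + h (s.2 + q ⟨t, ht⟩), s.2 + g (s.1 + p ⟨t, ht⟩)) else s

lemma gameState_succ (g h : (Fin k → ℝ) → Fin k → ℝ) (p q : Fin T → Fin k → ℝ) {t : ℕ}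
    (ht : t < T) : gameState g h p q (t + 1) =
      ((gameState g h p q t).1 + h ((gameState g h p q t).2 + q ⟨t, ht⟩),
        (gameState g h p q t).2 + g ((gameState g h p q t).1 + p ⟨t, ht⟩)) := by
  simp [gameState, ht]

/-- The state before round `t` ignores the perturbations of round `t` and later; this is the
adaptedness required by Azuma–Hoeffding. -/
lemma gameState_update (g h : (Fin k → ℝ) → Fin k → ℝ) (p q : Fin T → Fin k → ℝ) (i : Fin T)
    (x y : Fin k → ℝ) (t : ℕ) (ht : t ≤ i) :
    gameState g h (Function.update p i x) (Function.update q i y) t = gameState g h p q t := by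
  induction t with
  | zero => rfl
  | succ t ih =>
    have htT : t < T := by have := i.2; omega
    have hne : (⟨t, htT⟩ : Fin T) ≠ i := by
      intro h; have := congrArg Fin.val h; simp at this; omega
    rw [gameState_succ _ _ _ _ htT, gameState_succ _ _ _ _ htT, ih (by omega),
      Function.update_of_ne hne, Function.update_of_ne hne]

variable {Ω : Type*} [MeasurableSpace Ω]

lemma measurable_gameState {g h : (Fin k → ℝ) → Fin k → ℝ} (hg : Measurable g) (hh : Measurable h)
    {p q : Ω → Fin T → Fin k → ℝ} (hp : Measurable p) (hq : Measurable q) (t : ℕ) :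
    Measurable fun ω => gameState g h (p ω) (q ω) t := by
  induction t with
  | zero => exact measurable_const
  | succ t ih =>
    by_cases ht : t < T
    · simp only [gameState_succ _ _ _ _ ht]
      fun_prop
    · simpa [gameState, ht] using ih

/-- The difference between the average payoffs of round `t` when one of the two players' current
perturbations is resampled. -/
noncomputable def gameNoise (ν : Measure (Fin k → ℝ)) (g h : (Fin k → ℝ) → Fin k → ℝ) (t : ℕ)
    (p q : Fin T → Fin k → ℝ) : ℝ :=
  if ht : t < T then
    ∫ x, g ((gameState g h p q t).1 + x) ⬝ᵥ h ((gameState g h p q t).2 + q ⟨t, ht⟩) ∂ν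
      - ∫ y, g ((gameState g h p q t).1 + p ⟨t, ht⟩) ⬝ᵥ h ((gameState g h p q t).2 + y) ∂ν
  else 0

lemma measurable_gameNoise (ν : Measure (Fin k → ℝ)) [IsProbabilityMeasure ν]
    {g h : (Fin k → ℝ) → Fin k → ℝ} (hg : Measurable g) (hh : Measurable h)
    {p q : Ω → Fin T → Fin k → ℝ} (hp : Measurable p) (hq : Measurable q) (t : ℕ) :
    Measurable fun ω => gameNoise ν g h t (p ω) (q ω) := by
  by_cases ht : t < T
  · have hs := measurable_gameState hg hh hp hq t
    simp only [gameNoise, ht, dite_true]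
    have hs' : Measurable fun z : Ω × (Fin k → ℝ) => gameState g h (p z.1) (q z.1) t :=
      hs.comp measurable_fst
    have m1 : Measurable fun z : Ω × (Fin k → ℝ) =>
        g ((gameState g h (p z.1) (q z.1) t).1 + z.2)
          ⬝ᵥ h ((gameState g h (p z.1) (q z.1) t).2 + q z.1 ⟨t, ht⟩) := by
      fun_prop
    have m2 : Measurable fun z : Ω × (Fin k → ℝ) =>
        g ((gameState g h (p z.1) (q z.1) t).1 + p z.1 ⟨t, ht⟩)
          ⬝ᵥ h ((gameState g h (p z.1) (q z.1) t).2 + z.2) := by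
      fun_prop
    exact (m1.stronglyMeasurable.integral_prod_right').measurable.sub
      (m2.stronglyMeasurable.integral_prod_right').measurable
  · simp [gameNoise, ht]

lemma abs_integral_le_of_abs_le {X : Type*} [MeasurableSpace X] {ν : Measure X}
    [IsProbabilityMeasure ν] {f : X → ℝ} {B : ℝ} (hB : ∀ x, |f x| ≤ B) : |∫ x, f x ∂ν| ≤ B := by
  have := norm_integral_le_of_norm_le_const (μ := ν) (f := f) (C := B) (Filter.Eventually.of_forall hB)
  simpa using this

/-- With the pair of perturbations of a round as one coordinate, the noise is an adapted sequence
bounded by `2B`. Its conditional mean is zero because averaging the payoff over one variable and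
then the other gives the same in both orders. -/
lemma gameNoise_concentration (ν : Measure (Fin k → ℝ)) [IsProbabilityMeasure ν]
    {g h : (Fin k → ℝ) → Fin k → ℝ} (hg : Measurable g) (hh : Measurable h) {B : ℝ} (hB0 : 0 < B)
    (hB : ∀ x y, |g x ⬝ᵥ h y| ≤ B) (hT : 0 < T) {l : ℝ} (hl : 0 ≤ l) :
    1 - ENNReal.ofReal (Real.exp (-(l ^ 2 / (8 * B ^ 2 * T)))) ≤
      ((Measure.pi fun _ : Fin T => ν).prod (Measure.pi fun _ : Fin T => ν))
        {ω | ∑ t ∈ Finset.range T, gameNoise ν g h t ω.1 ω.2 ≤ l} := by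
  -- Identifies a pair of sequences with a sequence of independent pairs.
  have hpres := measurePreserving_arrowProdEquivProdArrow (Fin k → ℝ) (Fin k → ℝ) (Fin T)
    (fun _ => ν) (fun _ => ν)
  have hsum : Measurable fun ω : (Fin T → Fin k → ℝ) × (Fin T → Fin k → ℝ) =>
      ∑ t ∈ Finset.range T, gameNoise ν g h t ω.1 ω.2 :=
    Finset.measurable_sum _ fun t _ => measurable_gameNoise ν hg hh measurable_fst measurable_snd t
  have hset : MeasurableSet {ω : (Fin T → Fin k → ℝ) × (Fin T → Fin k → ℝ) |
      l < ∑ t ∈ Finset.range T, gameNoise ν g h t ω.1 ω.2} :=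
    measurableSet_lt measurable_const hsum
  have hcompl : {ω : (Fin T → Fin k → ℝ) × (Fin T → Fin k → ℝ) |
      ∑ t ∈ Finset.range T, gameNoise ν g h t ω.1 ω.2 ≤ l}
      = {ω | l < ∑ t ∈ Finset.range T, gameNoise ν g h t ω.1 ω.2}ᶜ := by
    ext ω; simp
  rw [hcompl, prob_compl_eq_one_sub hset, ← hpres.measure_preimage hset.nullMeasurableSet]
  apply tsub_le_tsub_left
  have key := measure_sum_gt_le (ν := ν.prod ν) (T := T)
    (D := fun t ω => gameNoise ν g h t (fun i => (ω i).1) (fun i => (ω i).2))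
    (B := 2 * B) (by linarith) hT
    (fun n _ => measurable_gameNoise ν hg hh (by fun_prop) (by fun_prop) n)
    (fun n hn ω => ?_) (fun n hn i ω x hni => ?_) (fun n hn ω => ?_) hl
  · refine key.trans (le_of_eq ?_)
    congr 4
    ring
  · simp only [gameNoise, hn, dite_true]
    refine (abs_sub _ _).trans ?_
    rw [two_mul]
    exact add_le_add (abs_integral_le_of_abs_le fun x => hB _ _)
      (abs_integral_le_of_abs_le fun x => hB _ _)
  · have e1 : (fun j => (Function.update ω i x j).1) = Function.update (fun j => (ω j).1) i x.1 := by
      ext1 j; by_cases hj : j = i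
      · subst hj; simp
      · simp [hj]
    have e2 : (fun j => (Function.update ω i x j).2) = Function.update (fun j => (ω j).2) i x.2 := by
      ext1 j; by_cases hj : j = i
      · subst hj; simp
      · simp [hj]
    have hne : (⟨n, hn⟩ : Fin T) ≠ i := by
      intro h; have := congrArg Fin.val h; simp at this; omega
    simp only [e1, e2, gameNoise, hn, dite_true, gameState_update g h _ _ i x.1 x.2 n hni.le,
      Function.update_of_ne hne]
  · have e1 : ∀ x : (Fin k → ℝ) × (Fin k → ℝ), (fun j => (Function.update ω ⟨n, hn⟩ x j).1)
        = Function.update (fun j => (ω j).1) ⟨n, hn⟩ x.1 := by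
      intro x; ext1 j; by_cases hj : j = ⟨n, hn⟩
      · subst hj; simp
      · simp [hj]
    have e2 : ∀ x : (Fin k → ℝ) × (Fin k → ℝ), (fun j => (Function.update ω ⟨n, hn⟩ x j).2)
        = Function.update (fun j => (ω j).2) ⟨n, hn⟩ x.2 := by
      intro x; ext1 j; by_cases hj : j = ⟨n, hn⟩
      · subst hj; simp
      · simp [hj]
    simp only [e1, e2, gameNoise, hn, dite_true,
      gameState_update g h _ _ (⟨n, hn⟩ : Fin T) _ _ n le_rfl, Function.update_self]
    set s := gameState g h (fun j => (ω j).1) (fun j => (ω j).2) n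
    have hG : Integrable (fun z : (Fin k → ℝ) × (Fin k → ℝ) => g (s.1 + z.1) ⬝ᵥ h (s.2 + z.2))
        (ν.prod ν) := integrable_of_abs_le (by fun_prop) fun z => hB _ _
    have h0 := integral_sub_averages_eq_zero hG
    -- `gameNoise` subtracts the two averages in the opposite order.
    rw [← neg_eq_zero, ← integral_neg, ← h0]
    simp only [neg_sub]

end Game

end MaxminFPL

namespace MaxminFPL

open Matrix OracleProg

universe u v

/-! ## The polytope of consistent weights and its oracle -/

section Polytope

variable {S : Type u} {A : Type v} [Fintype S] {k : ℕ} {M : MDP S A k} {πE : Policy S A}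
  {ε η : ℝ} {alg : (Fin k → ℝ) → ℝ → Policy S A}

lemma MDP.features_nonneg (M : MDP S A k) (π : Policy S A) (j : Fin k) : 0 ≤ M.features π j :=
  tsum_nonneg fun t => mul_nonneg (pow_nonneg M.γ_nonneg t) <|
    Finset.sum_nonneg fun s _ => mul_nonneg ENNReal.toReal_nonneg (M.φ_mem s j).1

lemma abs_features_dotProduct_le (hM : ∀ μ ∈ M.featureSet, ∑ j, |μ j| ≤ k) (π : Policy S A)
    {w : Fin k → ℝ} {b : ℝ} (hb : 0 ≤ b) (hw : ∀ j, |w j| ≤ b) : |M.features π ⬝ᵥ w| ≤ b * k :=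
  (abs_dotProduct_le_sum_abs hw).trans (mul_le_mul_of_nonneg_left (hM _ ⟨π, rfl⟩) hb)

lemma convex_consistentWeights : Convex ℝ (M.consistentWeights πE ε) := by
  intro x hx y hy a b ha hb hab
  refine ⟨fun j => ?_, fun μ hμ => ?_⟩
  · have h1 := hx.1 j
    have h2 := hy.1 j
    simp only [Pi.add_apply, Pi.smul_apply, smul_eq_mul]
    refine (abs_add_le _ _).trans ?_
    rw [abs_mul, abs_mul, abs_of_nonneg ha, abs_of_nonneg hb]
    nlinarith
  · have h1 := hx.2 μ hμ
    have h2 := hy.2 μ hμ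
    simp only [add_dotProduct, smul_dotProduct, smul_eq_mul]
    have h3 := mul_le_mul_of_nonneg_left h1 ha
    have h4 := mul_le_mul_of_nonneg_left h2 hb
    have h5 : a * ε + b * ε = ε := by rw [← add_mul, hab, one_mul]
    linarith

lemma mem_consistentWeights_of_small (hM : ∀ μ ∈ M.featureSet, ∑ j, |μ j| ≤ k) {r : ℝ}
    (hr0 : 0 ≤ r) (hr1 : r ≤ 1) (hr : 2 * r * k ≤ ε) {w : Fin k → ℝ} (hw : ∀ j, |w j| ≤ r) :
    w ∈ M.consistentWeights πE ε := by
  refine ⟨fun j => (hw j).trans hr1, ?_⟩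
  rintro _ ⟨π, rfl⟩
  have h1 := abs_le.1 (abs_features_dotProduct_le hM πE hr0 hw)
  have h2 := abs_le.1 (abs_features_dotProduct_le hM π hr0 hw)
  rw [dotProduct_comm w, dotProduct_comm w]
  linarith

lemma zero_mem_consistentWeights (hε : 0 ≤ ε) : (0 : Fin k → ℝ) ∈ M.consistentWeights πE ε :=
  ⟨by simp, by simpa using fun _ _ => hε⟩

/-- Only `Ψ(alg x η) ∈ P_F` matters here: the answer NO exhibits a violated constraint of `P_R`,
whatever the accuracy of the solver. -/
lemma wso_separates {x g : Fin k → ℝ} {b : ℝ} (hx : M.wso alg πE ε η x = some (g, b))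
    {y : Fin k → ℝ} (hy : y ∈ M.consistentWeights πE ε) : g ⬝ᵥ x < g ⬝ᵥ y := by
  unfold MDP.wso at hx
  split_ifs at hx with h
  simp only [Option.some.injEq, Prod.mk.injEq] at hx
  rw [← hx.1, sub_dotProduct, sub_dotProduct]
  have h2 := hy.2 _ ⟨alg x η, rfl⟩
  rw [dotProduct_comm y, dotProduct_comm y] at h2
  linarith

/-- Acceptance bounds the expert's suboptimality under `x` only by `ε + η`. Suboptimality is linear
in the weights, so scaling brings it down to `ε`. -/
lemma smul_mem_consistentWeights_of_accepted (hη : 0 < η) (hε : 0 < ε)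
    (halg : M.IsApproxSolver alg) {x : Fin k → ℝ} (hbox : ∀ j, |x j| ≤ 1)
    (hx : M.wso alg πE ε η x = none) : (ε / (ε + η)) • x ∈ M.consistentWeights πE ε := by
  unfold MDP.wso at hx
  split_ifs at hx with h
  have hθ0 : 0 < ε / (ε + η) := by positivity
  have hθ1 : ε / (ε + η) ≤ 1 := by rw [div_le_one (by positivity)]; linarith
  refine ⟨fun j => ?_, ?_⟩
  · rw [Pi.smul_apply, smul_eq_mul, abs_mul, abs_of_pos hθ0]
    exact mul_le_one₀ hθ1 (abs_nonneg _) (hbox j)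
  · rintro _ ⟨π, rfl⟩
    have h1 := halg x η hη π
    have h2 : x ⬝ᵥ M.features π - x ⬝ᵥ M.features πE ≤ ε + η := by
      rw [dotProduct_comm _ x, dotProduct_comm _ x] at h
      linarith
    simp only [smul_dotProduct, smul_eq_mul]
    have h3 := mul_le_mul_of_nonneg_left h2 hθ0.le
    have h4 : ε / (ε + η) * (ε + η) = ε := by field_simp
    nlinarith

lemma measurableOracle_wso (halg : Measurable fun w => M.features (alg w η)) :
    MeasurableOracle (M.wso alg πE ε η) := by
  refine ⟨?_, fun x => M.features πE - M.features (alg x η), by fun_prop, fun x h b hx => ?_⟩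
  · have : {x | M.wso alg πE ε η x = none}
        = {x | M.features (alg x η) ⬝ᵥ x ≤ M.features πE ⬝ᵥ x + ε} := by
      ext x; simp [MDP.wso]
    rw [this]
    exact measurableSet_le (by fun_prop) (by fun_prop)
  · unfold MDP.wso at hx
    split_ifs at hx
    simp only [Option.some.injEq, Prod.mk.injEq] at hx
    exact hx.1.symm

lemma maxminValue_le (hM : ∀ μ ∈ M.featureSet, ∑ j, |μ j| ≤ k) {b : ℝ}
    (h : ∀ μ ∈ M.featureSet, ∃ w ∈ M.consistentWeights πE ε, μ ⬝ᵥ w ≤ b) :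
    M.maxminValue πE ε ≤ b := by
  refine csSup_le ⟨_, _, ⟨πE, rfl⟩, rfl⟩ ?_
  rintro _ ⟨μ, ⟨π, rfl⟩, rfl⟩
  obtain ⟨w, hw, hwb⟩ := h _ ⟨π, rfl⟩
  -- The lower bound `-k` is needed because a real infimum of an unbounded set would be a default
  -- value.
  refine (csInf_le (s := (fun w => M.features π ⬝ᵥ w) '' M.consistentWeights πE ε)
    ⟨-(1 * (k : ℝ)), ?_⟩
    ⟨w, hw, rfl⟩).trans hwb
  rintro _ ⟨y, hy, rfl⟩
  exact (abs_le.1 (abs_features_dotProduct_le hM π zero_le_one hy.1)).1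

end Polytope

/-! ## The number of iterations -/

section Iterations

/-- The parameter in which the running time is polynomial. -/
noncomputable def sizeParam (k T : ℕ) (ε c : ℝ) : ℝ :=
  k * (1 + Real.log T + Real.log (1 + 1 / ε) + Real.log (1 + 1 / c))

/-- The number of ellipsoid iterations. -/
noncomputable def ellipsoidIters (k T : ℕ) (ε c : ℝ) : ℕ := 31 * ⌈sizeParam k T ε c⌉₊ ^ 3

/-- The number of binary search steps. -/
noncomputable def searchIters (k T : ℕ) (ε c : ℝ) : ℕ := 31 * ⌈sizeParam k T ε c⌉₊

/-- Half-width of a cube about the origin that consists of consistent weights. -/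
noncomputable def innerRadius (k : ℕ) (ε : ℝ) : ℝ := 1 / (2 * k * (1 + 1 / ε))

/-- How far the feasible region is shrunk towards the inner cube. -/
noncomputable def shrinkage (k T : ℕ) (c : ℝ) : ℝ := 1 / (16 * (k : ℝ) ^ 2 * T * (1 + 1 / c))

variable {k T : ℕ} {ε c : ℝ}

lemma log_natCast_le (n : ℕ) : Real.log n ≤ n :=
  Real.log_le_self n.cast_nonneg

lemma sizeParam_bounds (hk : 0 < k) (hε : 0 < ε) (hc : 0 < c) :
    1 ≤ sizeParam k T ε c ∧ (k : ℝ) ≤ sizeParam k T ε c ∧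
      1 + Real.log T + Real.log (1 + 1 / ε) + Real.log (1 + 1 / c) ≤ sizeParam k T ε c := by
  have hk' : (1 : ℝ) ≤ k := by exact_mod_cast hk
  have h1 : 0 ≤ Real.log T := Real.log_natCast_nonneg T
  have h2 : 0 ≤ Real.log (1 + 1 / ε) := Real.log_nonneg (by simpa using hε.le)
  have h3 : 0 ≤ Real.log (1 + 1 / c) := Real.log_nonneg (by simpa using hc.le)
  unfold sizeParam
  refine ⟨?_, ?_, ?_⟩ <;> nlinarith

lemma iters_mul_le (hk : 0 < k) (hε : 0 < ε) (hc : 0 < c) :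
    ((ellipsoidIters k T ε c * searchIters k T ε c : ℕ) : ℝ)
      ≤ (15376 : ℕ) * sizeParam k T ε c ^ 4 := by
  obtain ⟨h1, -, -⟩ := sizeParam_bounds (T := T) hk hε hc
  have h2 : (⌈sizeParam k T ε c⌉₊ : ℝ) ≤ 2 * sizeParam k T ε c := by
    have := Nat.ceil_lt_add_one (zero_le_one.trans h1)
    linarith
  calc ((ellipsoidIters k T ε c * searchIters k T ε c : ℕ) : ℝ)
      = 961 * (⌈sizeParam k T ε c⌉₊ : ℝ) ^ 4 := by
        unfold ellipsoidIters searchIters; push_cast; ring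
    _ ≤ 961 * (2 * sizeParam k T ε c) ^ 4 := by gcongr
    _ = _ := by push_cast; ring

lemma log_two_bounds : 1 / 2 ≤ Real.log 2 ∧ Real.log 2 ≤ 3 / 4 :=
  ⟨by linarith [Real.log_two_gt_d9], by linarith [Real.log_two_lt_d9]⟩

lemma ellipsoidIters_spec (hk : 0 < k) (hT : 0 < T) (hε : 0 < ε) (hc : 0 < c) :
    Real.exp (-(1 / ((k : ℝ) + 1))) ^ ellipsoidIters k T ε c * (k : ℝ) ^ k
      < ((shrinkage k T c * innerRadius k ε) ^ 2) ^ k := by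
  obtain ⟨h1, h2, h3⟩ := sizeParam_bounds (T := T) hk hε hc
  set m := sizeParam k T ε c with hm
  have hk' : (0 : ℝ) < k := by exact_mod_cast hk
  have hk1 : (1 : ℝ) ≤ k := by exact_mod_cast hk
  have hT' : (0 : ℝ) < T := by exact_mod_cast hT
  have hcε : 0 < 1 + 1 / ε := by positivity
  have hcc : 0 < 1 + 1 / c := by positivity
  have hprod : shrinkage k T c * innerRadius k ε
      = (2 ^ 5 * (k : ℝ) ^ 3 * T * (1 + 1 / ε) * (1 + 1 / c))⁻¹ := by
    unfold shrinkage innerRadius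
    rw [div_mul_div_comm, one_mul, one_div]; congr 1; ring
  have hlog : Real.log (shrinkage k T c * innerRadius k ε)
      = -(5 * Real.log 2 + 3 * Real.log k + Real.log T + Real.log (1 + 1 / ε)
        + Real.log (1 + 1 / c)) := by
    rw [hprod, Real.log_inv, Real.log_mul (by positivity) hcc.ne',
      Real.log_mul (by positivity) hcε.ne', Real.log_mul (by positivity) hT'.ne',
      Real.log_mul (by positivity) (by positivity), Real.log_pow, Real.log_pow]
    push_cast; ring
  have hpos : 0 < shrinkage k T c * innerRadius k ε := by rw [hprod]; positivity
  rw [← Real.log_lt_log_iff (by positivity) (by positivity),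
    Real.log_mul (by positivity) (by positivity), Real.log_pow, Real.log_pow, Real.log_pow,
    Real.log_pow, Real.log_exp, hlog]
  have hceil : m ≤ ⌈m⌉₊ := Nat.le_ceil m
  have hN : (30 : ℝ) * m ^ 3 < ellipsoidIters k T ε c := by
    unfold ellipsoidIters
    push_cast
    have h4 : m ^ 3 ≤ (⌈m⌉₊ : ℝ) ^ 3 := by gcongr
    have h5 : 1 ≤ m ^ 3 := one_le_pow₀ h1
    linarith
  -- After taking logarithms, `k` times a bracket of at most `15 m` must stay below `N / (k + 1)`;
  -- `k (k + 1) ≤ 2 m²` accounts for `30 m³`, and the surplus of 31 over 30 makes the inequality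
  -- strict.
  have hdiv : (30 : ℝ) * m ^ 3 / (k + 1) < ellipsoidIters k T ε c / (k + 1) := by gcongr
  have hlk := log_natCast_le k
  have hl2 := log_two_bounds.2
  have hbound : 2 * (5 * Real.log 2 + 3 * Real.log k + Real.log T + Real.log (1 + 1 / ε)
        + Real.log (1 + 1 / c)) + Real.log k ≤ 15 * m := by
    linarith
  have hcube : k * (15 * m) ≤ 30 * m ^ 3 / (k + 1) := by
    rw [le_div_iff₀ (by linarith)]
    have h6 : (k : ℝ) * (k + 1) ≤ m * (2 * m) := by
      apply mul_le_mul h2 (by linarith) (by linarith) (by linarith)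
    nlinarith
  have hkb := mul_le_mul_of_nonneg_left hbound hk'.le
  have e : (ellipsoidIters k T ε c : ℝ) * -(1 / ((k : ℝ) + 1))
      = -(ellipsoidIters k T ε c / (k + 1)) := by ring
  rw [e]
  push_cast
  linarith

/-- `2 k² T` bounds the ℓ¹ norm of every objective that occurs, hence the length of the initial
search interval. -/
lemma searchIters_spec (hk : 0 < k) (hT : 0 < T) (hε : 0 < ε) (hc : 0 < c) :
    2 * (k : ℝ) ^ 2 * T / 2 ^ searchIters k T ε c ≤ c / 4 := by
  obtain ⟨h1, h2, h3⟩ := sizeParam_bounds (T := T) hk hε hc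
  set m := sizeParam k T ε c with hm
  have hk' : (0 : ℝ) < k := by exact_mod_cast hk
  have hT' : (0 : ℝ) < T := by exact_mod_cast hT
  have hcc : 0 < 1 + 1 / c := by positivity
  have h4 : 2 ^ 3 * (k : ℝ) ^ 2 * T * (1 + 1 / c) ≤ 2 ^ searchIters k T ε c := by
    rw [← Real.log_le_log_iff (by positivity) (by positivity), Real.log_pow,
      Real.log_mul (by positivity) hcc.ne', Real.log_mul (by positivity) hT'.ne',
      Real.log_mul (by positivity) (by positivity), Real.log_pow, Real.log_pow]
    have hJ : 31 * m ≤ searchIters k T ε c := by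
      unfold searchIters
      push_cast
      linarith [Nat.le_ceil m]
    have hlk := log_natCast_le k
    have hε' : 0 ≤ Real.log (1 + 1 / ε) := Real.log_nonneg (by simpa using hε.le)
    have := log_two_bounds
    push_cast
    nlinarith
  have h5 : 2 ^ 3 * (k : ℝ) ^ 2 * T * (1 / c) ≤ 2 ^ searchIters k T ε c := by
    refine le_trans ?_ h4
    gcongr
    linarith
  rw [div_le_iff₀ (by positivity)]
  have h6 := mul_le_mul_of_nonneg_left h5 hc.le
  have h7 : c * (2 ^ 3 * (k : ℝ) ^ 2 * T * (1 / c)) = 8 * (k : ℝ) ^ 2 * T := by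
    field_simp; norm_num
  linarith

lemma innerRadius_bounds (hk : 0 < k) (hε : 0 < ε) :
    0 ≤ innerRadius k ε ∧ innerRadius k ε ≤ 1 ∧ 2 * innerRadius k ε * k ≤ ε := by
  have hk1 : (1 : ℝ) ≤ k := by exact_mod_cast hk
  unfold innerRadius
  refine ⟨by positivity, ?_, ?_⟩
  · have : 0 < 1 / ε := by positivity
    rw [div_le_one (by positivity)]
    nlinarith
  -- The factor `1 + 1/ε` yields `ε / (ε + 1)`, which is below both `ε` and `1`; `shrinkage` uses
  -- the same device with `c`.
  · have e : 2 * (1 / (2 * k * (1 + 1 / ε))) * k = ε / (ε + 1) := by field_simp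
    rw [e, div_le_iff₀ (by positivity)]
    nlinarith

lemma shrinkage_bounds (hk : 0 < k) (hT : 0 < T) (hc : 0 < c) :
    0 ≤ shrinkage k T c ∧ shrinkage k T c ≤ 1 ∧
      2 * shrinkage k T c * (2 * (k : ℝ) ^ 2 * T) ≤ c / 4 := by
  have hk1 : (1 : ℝ) ≤ k := by exact_mod_cast hk
  have hT1 : (1 : ℝ) ≤ T := by exact_mod_cast hT
  unfold shrinkage
  refine ⟨by positivity, ?_, ?_⟩
  · have h1 : 0 < 1 / c := by positivity
    have h2 : 1 ≤ (k : ℝ) ^ 2 * T := one_le_mul_of_one_le_of_one_le (one_le_pow₀ hk1) hT1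
    rw [div_le_one (by positivity)]
    nlinarith
  · have e : 2 * (1 / (16 * (k : ℝ) ^ 2 * T * (1 + 1 / c))) * (2 * (k : ℝ) ^ 2 * T)
        = c / (c + 1) / 4 := by field_simp; norm_num
    rw [e]
    gcongr
    rw [div_le_iff₀ (by positivity)]
    nlinarith

end Iterations

/-! ## The plays of the two players -/

section Plays

variable {S : Type u} {A : Type v} [Fintype S] {k T : ℕ} {M : MDP S A k} {πE : Policy S A}
  {ε c : ℝ} {alg : (Fin k → ℝ) → ℝ → Policy S A}

/-- The feature vector that answers the perturbed sum `x` of the weights. -/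
noncomputable def featurePlay (M : MDP S A k) (alg : (Fin k → ℝ) → ℝ → Policy S A) (T : ℕ) (c : ℝ)
    (x : Fin k → ℝ) : Fin k → ℝ :=
  M.features (alg ((1 / (T : ℝ)) • x) (eta₁ T c))

/-- The weights that answer the perturbed sum `x` of the feature vectors. -/
noncomputable def weightPlay (M : MDP S A k) (alg : (Fin k → ℝ) → ℝ → Policy S A)
    (πE : Policy S A) (T : ℕ) (ε c : ℝ) (N J : ℕ) (x : Fin k → ℝ) : Fin k → ℝ :=
  (ε / (ε + eta₂ k T ε c)) •
    (lpMinimize x N J).eval alg M.features (M.wso alg πE ε (eta₂ k T ε c))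

lemma roundProg_eval (alg : (Fin k → ℝ) → ℝ → Policy S A) (T : ℕ) (ε c : ℝ) (N J : ℕ)
    (W m p q : Fin k → ℝ) :
    (roundProg T ε c N J W m p q).eval alg M.features (M.wso alg πE ε (eta₂ k T ε c))
      = ⟨alg ((1 / (T : ℝ)) • (W + p)) (eta₁ T c), featurePlay M alg T c (W + p),
        weightPlay M alg πE T ε c N J (m + q)⟩ := by
  rw [roundProg, eval, eval_bind]
  rfl

/-- The oracle programs thus realize the abstract game, to which the probabilistic argument applies.
-/
lemma sumsBefore_eq_gameState (N J : ℕ) (p q : Fin T → Fin k → ℝ) (t : ℕ) :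
    sumsBefore M alg πE T ε c N J p q t
      = gameState (featurePlay M alg T c) (weightPlay M alg πE T ε c N J) p q t := by
  induction t with
  | zero => rfl
  | succ t ih =>
    simp only [sumsBefore, gameState, ih, roundProg_eval]

lemma features_policies (N J : ℕ) (p q : Fin T → Fin k → ℝ) (t : Fin T) :
    M.features (policies M alg πE T ε c N J p q t) = featurePlay M alg T c
      ((gameState (featurePlay M alg T c) (weightPlay M alg πE T ε c N J) p q t).1 + p t) := by
  rw [policies, roundAt, roundProg_eval, sumsBefore_eq_gameState]
  rfl

/-- The query is scaled by `1/T`, so in terms of `x` the accuracy is `T η₁ = c/2`. -/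
lemma featurePlay_optimal (hT : 0 < T) (hc : 0 < c) (halg : M.IsApproxSolver alg)
    (x : Fin k → ℝ) (π : Policy S A) :
    x ⬝ᵥ M.features π - c / 2 ≤ x ⬝ᵥ featurePlay M alg T c x := by
  have hT' : (0 : ℝ) < T := by exact_mod_cast hT
  have h := halg ((1 / (T : ℝ)) • x) (eta₁ T c) (by unfold eta₁; positivity) π
  simp only [smul_dotProduct, smul_eq_mul] at h
  have h2 := mul_le_mul_of_nonneg_left h hT'.le
  unfold eta₁ at h2
  unfold featurePlay eta₁
  calc _ = (T : ℝ) * (1 / T * x ⬝ᵥ M.features π - c / (2 * T)) := by field_simp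
    _ ≤ _ := h2
    _ = _ := by field_simp

lemma eta₂_pos (hε : 0 < ε) (hc : 0 < c) (hck : c < 2 * (k : ℝ) ^ 2 * T) : 0 < eta₂ k T ε c :=
  div_pos (mul_pos hc hε) (by linarith)

lemma scale_eq (hε : 0 < ε) (hc : 0 < c) (hck : c < 2 * (k : ℝ) ^ 2 * T) :
    ε / (ε + eta₂ k T ε c) = 1 - c / (2 * (k : ℝ) ^ 2 * T) := by
  have h1 : 0 < 2 * (k : ℝ) ^ 2 * T - c := by linarith
  have h2 : 0 < 2 * (k : ℝ) ^ 2 * T := by linarith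
  unfold eta₂
  have e : ε + c * ε / (2 * (k : ℝ) ^ 2 * T - c)
      = ε * (2 * (k : ℝ) ^ 2 * T) / (2 * (k : ℝ) ^ 2 * T - c) := by
    rw [eq_div_iff h1.ne', add_mul, div_mul_cancel₀ _ h1.ne']; ring
  rw [e, div_div_eq_mul_div, mul_div_mul_left _ _ hε.ne', sub_div, div_self h2.ne']

/-- The error `3c/2` consists of `c` for scaling the accepted point back into `P_R`, `c/4` for
shrinking towards the inner cube and `c/4` for stopping the binary search. -/
lemma weightPlay_spec (hk : 0 < k) (hT : 0 < T) (hε : 0 < ε) (hc : 0 < c)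
    (hck : c < 2 * (k : ℝ) ^ 2 * T) (hM : ∀ μ ∈ M.featureSet, ∑ j, |μ j| ≤ k)
    (halg : M.IsApproxSolver alg) (x : Fin k → ℝ) :
    let y := weightPlay M alg πE T ε c (ellipsoidIters k T ε c) (searchIters k T ε c) x
    y ∈ M.consistentWeights πE ε ∧ (∑ j, |x j| ≤ 2 * (k : ℝ) ^ 2 * T →
      ∀ w ∈ M.consistentWeights πE ε, x ⬝ᵥ y ≤ x ⬝ᵥ w + 3 * c / 2) := by
  obtain ⟨r0, r1, r2⟩ := innerRadius_bounds hk hε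
  obtain ⟨l0, l1, l2⟩ := shrinkage_bounds hk hT hc
  obtain ⟨h1, h2, h3⟩ := lpMinimize_spec (alg := alg) (Ψ := M.features)
    (wso := M.wso alg πE ε (eta₂ k T ε c)) hk (convex_consistentWeights (M := M) (πE := πE) (ε := ε))
    (fun y hy => hy.1) r0 (fun y hy => mem_consistentWeights_of_small hM r0 r1 r2 hy)
    (fun x h b hx y hy => wso_separates hx hy) (J := searchIters k T ε c) l0 l1
    (ellipsoidIters_spec hk hT hε hc) x
  set z := (lpMinimize x (ellipsoidIters k T ε c) (searchIters k T ε c)).eval alg M.features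
    (M.wso alg πE ε (eta₂ k T ε c)) with hz
  refine ⟨?_, fun hx w hw => ?_⟩
  · unfold weightPlay
    rw [← hz]
    rcases h1 with h1 | ⟨h1, h1'⟩
    · rw [h1, smul_zero]; exact zero_mem_consistentWeights hε.le
    · exact smul_mem_consistentWeights_of_accepted (eta₂_pos hε hc hck) hε halg h1 h1'
  · unfold weightPlay
    rw [← hz, dotProduct_smul, smul_eq_mul, scale_eq hε hc hck]
    have hD : 0 < 2 * (k : ℝ) ^ 2 * T := by linarith
    have hz1 : ∀ j, |z j| ≤ 1 := by
      rcases h1 with h1 | ⟨h1, -⟩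
      · simp [h1]
      · exact h1
    have h4 := (abs_le.1 (abs_dotProduct_le_sum_abs (s := x) hz1)).1
    have h5 : c / (2 * (k : ℝ) ^ 2 * T) * -(x ⬝ᵥ z) ≤ c := by
      rw [div_mul_eq_mul_div, div_le_iff₀ hD]
      exact mul_le_mul_of_nonneg_left (by linarith) hc.le
    have h6 : 2 * shrinkage k T c * ∑ j, |x j| ≤ c / 4 :=
      (mul_le_mul_of_nonneg_left hx (by positivity)).trans l2
    have h7 : (∑ j, |x j|) / 2 ^ searchIters k T ε c ≤ c / 4 :=
      (div_le_div_of_nonneg_right hx (by positivity)).trans (searchIters_spec hk hT hε hc)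
    have h8 := h3 w hw
    nlinarith

end Plays

end MaxminFPL

namespace MaxminFPL

open Matrix OracleProg

universe u v

/-! ## The guarantee for the output policy -/

section Guarantee

variable {S : Type u} {A : Type v} [Fintype S] {k T : ℕ} {M : MDP S A k} {πE : Policy S A}
  {ε c : ℝ} {alg : (Fin k → ℝ) → ℝ → Policy S A}

lemma measurable_featurePlay (hT : 0 < T) (hc : 0 < c)
    (hmeas : ∀ η, 0 < η → Measurable fun w => M.features (alg w η)) :
    Measurable (featurePlay M alg T c) := by
  have hT' : (0 : ℝ) < T := by exact_mod_cast hT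
  have := hmeas (eta₁ T c) (by unfold eta₁; positivity)
  exact this.comp (measurable_id.const_smul (1 / (T : ℝ)))

lemma measurable_weightPlay (hε : 0 < ε) (hc : 0 < c) (hck : c < 2 * (k : ℝ) ^ 2 * T)
    (hmeas : ∀ η, 0 < η → Measurable fun w => M.features (alg w η)) (N J : ℕ) :
    Measurable (weightPlay M alg πE T ε c N J) := by
  have h : Measurable fun x => (lpMinimize x N J).eval alg M.features
      (M.wso alg πE ε (eta₂ k T ε c)) :=
    lpMinimize_measurable (measurableOracle_wso (hmeas _ (eta₂_pos hε hc hck))) N J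
  exact h.const_smul (ε / (ε + eta₂ k T ε c))

lemma abs_featurePlay_dotProduct_le (hM : ∀ μ ∈ M.featureSet, ∑ j, |μ j| ≤ k) (x : Fin k → ℝ)
    {w : Fin k → ℝ} (hw : ∀ j, |w j| ≤ 1) : |featurePlay M alg T c x ⬝ᵥ w| ≤ k := by
  have h := abs_features_dotProduct_le hM (alg ((1 / (T : ℝ)) • x) (eta₁ T c)) zero_le_one hw
  rwa [one_mul] at h

lemma inv_delta (k T : ℕ) : 1 / delta k T = k * √T := by
  simp [delta]

lemma perturbationLaw_eq (k T : ℕ) :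
    perturbationLaw k T = Measure.pi fun _ : Fin T => cubeLaw k (k * √T) := by
  rw [perturbationLaw, inv_delta]; rfl

lemma sum_abs_le_of_mem_cube {L : ℝ} {q : Fin k → ℝ}
    (hq : q ∈ Set.Icc (0 : Fin k → ℝ) (fun _ => L)) : ∑ j, |q j| ≤ k * L := by
  calc ∑ j, |q j| ≤ ∑ _j : Fin k, L :=
        Finset.sum_le_sum fun j _ => by rw [abs_of_nonneg (hq.1 j)]; exact hq.2 j
    _ = k * L := by simp

lemma sum_abs_state_le {X v : ℕ → Fin k → ℝ} (hX0 : X 0 = 0)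
    (hX : ∀ t < T, X (t + 1) = X t + v t) {V : ℝ} (hV : ∀ t < T, ∑ j, |v t j| ≤ V) (t : ℕ)
    (ht : t ≤ T) : ∑ j, |X t j| ≤ t * V := by
  induction t with
  | zero => simp [hX0]
  | succ t ih =>
    rw [hX t (by omega)]
    calc ∑ j, |(X t + v t) j| ≤ ∑ j, (|X t j| + |v t j|) :=
          Finset.sum_le_sum fun j _ => abs_add_le _ _
      _ = ∑ j, |X t j| + ∑ j, |v t j| := Finset.sum_add_distrib
      _ ≤ t * V + V := add_le_add (ih (by omega)) (hV t (by omega))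
      _ = _ := by push_cast; ring

/-- The regret of the weight player. -/
lemma weightPlay_regret (hk : 0 < k) (hT : 0 < T) (hε : 0 < ε) (hc : 0 < c)
    (hck : c < 2 * (k : ℝ) ^ 2 * T) (hM : ∀ μ ∈ M.featureSet, ∑ j, |μ j| ≤ k)
    (halg : M.IsApproxSolver alg)
    (hmeas : ∀ η, 0 < η → Measurable fun w => M.features (alg w η)) {X v : ℕ → Fin k → ℝ}
    (hX0 : X 0 = 0) (hX : ∀ t < T, X (t + 1) = X t + v t) (hv : ∀ t < T, v t ∈ M.featureSet)
    {w : Fin k → ℝ} (hw : w ∈ M.consistentWeights πE ε) :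
    ∑ t ∈ Finset.range T, ∫ q, v t ⬝ᵥ weightPlay M alg πE T ε c (ellipsoidIters k T ε c)
        (searchIters k T ε c) (X t + q) ∂cubeLaw k (k * √T)
      ≤ ∑ t ∈ Finset.range T, v t ⬝ᵥ w + 2 * k * √T + k ^ 2 * √T + (T + 1) * (3 * c / 2) := by
  have hk' : (0 : ℝ) < k := by exact_mod_cast hk
  have hk1 : (1 : ℝ) ≤ k := by exact_mod_cast hk
  have hT' : (0 : ℝ) < T := by exact_mod_cast hT
  have hT1 : (1 : ℝ) ≤ T := by exact_mod_cast hT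
  have hs : 0 < √(T : ℝ) := Real.sqrt_pos.2 hT'
  have hss : √(T : ℝ) * √T = T := Real.mul_self_sqrt hT'.le
  have hs1 : √(T : ℝ) ≤ T := by
    rw [Real.sqrt_le_left hT'.le]; nlinarith
  have hL : 0 < (k : ℝ) * √T := by positivity
  have := isProbabilityMeasure_cubeLaw k hL
  have hplay := fun x => weightPlay_spec (πE := πE) hk hT hε hc hck hM halg x
  -- Two points of `[-1,1]^k` differ by at most `2 ‖q‖₁` under the objective `q ≥ 0`; the mean of
  -- this bound is `k L = k² √T`.
  have hb : Integrable (fun q : Fin k → ℝ => 2 * ∑ j, q j) (cubeLaw k (k * √T)) := by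
    refine Integrable.of_bound (by fun_prop) (2 * (k * (k * √T))) ?_
    filter_upwards [ae_mem_cube k (k * √T)] with q hq
    have h1 := sum_abs_le_of_mem_cube hq
    rw [norm_mul, Real.norm_ofNat]
    exact mul_le_mul_of_nonneg_left ((Finset.abs_sum_le_sum_abs _ _).trans h1) zero_le_two
  have hV : ∀ t < T, ∑ j, |v t j| ≤ k := fun t ht => hM _ (hv t ht)
  have h := fpl_regret hL (measurable_weightPlay hε hc hck hmeas _ _)
    (K := M.consistentWeights πE ε) (fun x => (hplay x).1) hX0 hX (B := k) (V := k)
    (e := 3 * c / 2) (R := k * (k * √T))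
    (fun t ht x => ?_) hk'.le hV (fun t ht q hq y hy => ?_) hw hb (fun q hq => ?_) ?_
  · refine h.trans (le_of_eq ?_)
    have e : (T : ℝ) * (2 * k * (k / (k * √T))) = 2 * k * √T := by
      field_simp
      rw [sq]; exact hss.symm
    rw [e]; ring
  · obtain ⟨π, hπ⟩ := hv t ht
    rw [← hπ]
    simpa using abs_features_dotProduct_le hM π zero_le_one (hplay x).1.1
  · refine (hplay _).2 ?_ y hy
    have h1 := sum_abs_state_le hX0 hX hV t ht
    have h2 := sum_abs_le_of_mem_cube hq
    have ht' : (t : ℝ) ≤ T := by exact_mod_cast ht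
    calc ∑ j, |(X t + q) j| ≤ ∑ j, (|X t j| + |q j|) :=
          Finset.sum_le_sum fun j _ => abs_add_le _ _
      _ = ∑ j, |X t j| + ∑ j, |q j| := Finset.sum_add_distrib
      -- Both terms are at most `k² T`, so the objective is in the range where the weight player is
      -- nearly optimal.
      _ ≤ T * k + k * (k * T) := by
          refine add_le_add (h1.trans (by gcongr)) (h2.trans (by gcongr))
      _ ≤ _ := by nlinarith [mul_nonneg hT'.le hk'.le]
  · have h1 := abs_le.1 (abs_dotProduct_le_sum_abs (s := q) hw.1)
    have h2 := abs_le.1 (abs_dotProduct_le_sum_abs (s := q) (hplay q).1.1)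
    have h3 : ∑ j, |q j| = ∑ j, q j := Finset.sum_congr rfl fun j _ => abs_of_nonneg (hq.1 j)
    rw [h3] at h1 h2
    linarith
  · rw [integral_const_mul, integral_cubeLaw_sum hL]
    apply le_of_eq; ring

/-- The regret of the feature player. -/
lemma featurePlay_regret (hk : 0 < k) (hT : 0 < T) (hc : 0 < c)
    (hM : ∀ μ ∈ M.featureSet, ∑ j, |μ j| ≤ k) (halg : M.IsApproxSolver alg)
    (hmeas : ∀ η, 0 < η → Measurable fun w => M.features (alg w η)) {X v : ℕ → Fin k → ℝ}
    (hX0 : X 0 = 0) (hX : ∀ t < T, X (t + 1) = X t + v t) (hv : ∀ t < T, ∀ j, |v t j| ≤ 1)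
    (π : Policy S A) :
    ∑ t ∈ Finset.range T, M.features π ⬝ᵥ v t
      ≤ ∑ t ∈ Finset.range T, ∫ q, featurePlay M alg T c (X t + q) ⬝ᵥ v t ∂cubeLaw k (k * √T)
        + 2 * k * √T + k ^ 2 * √T + (T + 1) * (c / 2) := by
  have hk' : (0 : ℝ) < k := by exact_mod_cast hk
  have hT' : (0 : ℝ) < T := by exact_mod_cast hT
  have hs : 0 < √(T : ℝ) := Real.sqrt_pos.2 hT'
  have hss : √(T : ℝ) * √T = T := Real.mul_self_sqrt hT'.le
  have hL : 0 < (k : ℝ) * √T := by positivity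
  have := isProbabilityMeasure_cubeLaw k hL
  -- Maximization over `P_F` is minimization over `-P_F`. A constant suffices for `b`: features are
  -- nonnegative, so only `q ⬝ᵥ featurePlay M alg T c q ≤ L k` has to be paid.
  have h := fpl_regret hL (h := fun x => -featurePlay M alg T c x)
    (measurable_featurePlay hT hc hmeas).neg (K := {y | -y ∈ M.featureSet})
    (fun x => ⟨_, (neg_neg _).symm⟩) hX0 hX (B := k) (V := k)
    (e := c / 2) (R := k ^ 2 * √T) (w := -M.features π) (b := fun _ => k ^ 2 * √T)
    (fun t ht x => ?_) hk'.le (fun t ht => ?_) (fun t ht q hq y hy => ?_) ⟨π, (neg_neg _).symm⟩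
    (integrable_const _) (fun q hq => ?_) (by simp)
  · simp only [dotProduct_neg, integral_neg, Finset.sum_neg_distrib] at h
    have e : (T : ℝ) * (2 * k * (k / (k * √T))) = 2 * k * √T := by
      field_simp
      rw [sq]; exact hss.symm
    rw [e] at h
    simp only [dotProduct_comm (M.features π), dotProduct_comm (featurePlay M alg T c _)]
    linarith
  · rw [dotProduct_neg, abs_neg, dotProduct_comm]
    exact abs_featurePlay_dotProduct_le hM x (hv t ht)
  · calc ∑ j, |v t j| ≤ ∑ _j : Fin k, (1 : ℝ) := Finset.sum_le_sum fun j _ => hv t ht j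
      _ = k := by simp
  · obtain ⟨π', hπ'⟩ := hy
    have h1 := featurePlay_optimal hT hc halg (X t + q) π'
    rw [hπ', dotProduct_neg] at h1
    rw [dotProduct_neg]
    linarith
  · rw [dotProduct_neg, dotProduct_neg]
    have h1 : 0 ≤ q ⬝ᵥ M.features π :=
      Finset.sum_nonneg fun j _ => mul_nonneg (hq.1 j) (M.features_nonneg π j)
    have h2 := (abs_le.1 (abs_features_dotProduct_le hM
      (alg ((1 / (T : ℝ)) • q) (eta₁ T c)) hL.le (w := q)
      (fun j => by rw [abs_of_nonneg (hq.1 j)]; exact hq.2 j))).2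
    rw [dotProduct_comm] at h2
    have e : (k : ℝ) * √T * k = k ^ 2 * √T := by ring
    rw [e] at h2
    unfold featurePlay
    linarith

/-- On the event that the noise is small, the output policy is nearly maxmin optimal. -/
lemma guarantee_of_noise_le (hk : 0 < k) (hT : 0 < T) (hε : 0 < ε) (hc : 0 < c)
    (hck : c < 2 * (k : ℝ) ^ 2 * T) (hM : ∀ μ ∈ M.featureSet, ∑ j, |μ j| ≤ k)
    (halg : M.IsApproxSolver alg)
    (hmeas : ∀ η, 0 < η → Measurable fun w => M.features (alg w η)) {p q : Fin T → Fin k → ℝ}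
    {l : ℝ}
    (hnoise : ∑ t ∈ Finset.range T, gameNoise (cubeLaw k (k * √T)) (featurePlay M alg T c)
      (weightPlay M alg πE T ε c (ellipsoidIters k T ε c) (searchIters k T ε c)) t p q ≤ l)
    {w : Fin k → ℝ} (hw : w ∈ M.consistentWeights πE ε) :
    M.maxminValue πE ε - (l + 4 * k * √T + 2 * k ^ 2 * √T) / T - 4 * c
      ≤ M.mixtureFeatures (policies M alg πE T ε c (ellipsoidIters k T ε c)
          (searchIters k T ε c) p q) ⬝ᵥ w := by
  have hT' : (0 : ℝ) < T := by exact_mod_cast hT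
  have hT1 : (1 : ℝ) ≤ T := by exact_mod_cast hT
  set N := ellipsoidIters k T ε c
  set J := searchIters k T ε c
  set g := featurePlay M alg T c with hg
  set h := weightPlay M alg πE T ε c N J with hh
  set s := gameState g h p q with hs
  -- The plays are extended by zero beyond round `T - 1`, which no sum reaches.
  obtain ⟨m, hmd⟩ : ∃ m : ℕ → Fin k → ℝ, ∀ t (ht : t < T), m t = g ((s t).1 + p ⟨t, ht⟩) :=
    ⟨fun t => if ht : t < T then g ((s t).1 + p ⟨t, ht⟩) else 0, fun t ht => by simp [ht]⟩
  obtain ⟨y, hyd⟩ : ∃ y : ℕ → Fin k → ℝ, ∀ t (ht : t < T), y t = h ((s t).2 + q ⟨t, ht⟩) :=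
    ⟨fun t => if ht : t < T then h ((s t).2 + q ⟨t, ht⟩) else 0, fun t ht => by simp [ht]⟩
  have hstep : ∀ t (ht : t < T), s (t + 1) = ((s t).1 + y t, (s t).2 + m t) := fun t ht => by
    rw [hs, gameState_succ _ _ _ _ ht, ← hs, hmd t ht, hyd t ht]
  have hy : ∀ t < T, y t ∈ M.consistentWeights πE ε := fun t ht => by
    rw [hyd t ht]
    exact (weightPlay_spec hk hT hε hc hck hM halg _).1
  have hregw := weightPlay_regret hk hT hε hc hck hM halg hmeas (X := fun t => (s t).2) (v := m)
    rfl (fun t ht => by rw [hstep t ht]) (fun t ht => by rw [hmd t ht]; exact ⟨_, rfl⟩) hw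
  have hregf := featurePlay_regret hk hT hc hM halg hmeas (X := fun t => (s t).1) (v := y)
    rfl (fun t ht => by rw [hstep t ht]) (fun t ht => (hy t ht).1)
  have hnoise' : ∑ t ∈ Finset.range T, ∫ x, g ((s t).1 + x) ⬝ᵥ y t ∂cubeLaw k (k * √T)
      - ∑ t ∈ Finset.range T, ∫ x, m t ⬝ᵥ h ((s t).2 + x) ∂cubeLaw k (k * √T) ≤ l := by
    rw [← Finset.sum_sub_distrib]
    refine le_trans (le_of_eq (Finset.sum_congr rfl fun t ht => ?_)) hnoise
    have ht' := Finset.mem_range.1 ht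
    rw [gameNoise, dif_pos ht', hmd t ht', hyd t ht']
  have hmix : M.mixtureFeatures (policies M alg πE T ε c N J p q) ⬝ᵥ w
      = (1 / (T : ℝ)) * ∑ t ∈ Finset.range T, m t ⬝ᵥ w := by
    rw [MDP.mixtureFeatures, smul_dotProduct, sum_dotProduct, Finset.sum_range, smul_eq_mul]
    congr 1
    refine Finset.sum_congr rfl fun t _ => ?_
    rw [features_policies, hmd t t.2]
  -- The average of the weights is the single witness that bounds the inner minimum for every `μ` in
  -- the maxmin value.
  have hW : ∑ t ∈ Finset.range T, (1 / (T : ℝ)) • y t ∈ M.consistentWeights πE ε :=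
    convex_consistentWeights.sum_mem (fun _ _ => by positivity) (by simp; field_simp)
      fun t ht => hy t (Finset.mem_range.1 ht)
  have hval : M.maxminValue πE ε ≤ M.mixtureFeatures (policies M alg πE T ε c N J p q) ⬝ᵥ w
      + (l + 4 * k * √T + 2 * k ^ 2 * √T) / T + 4 * c := by
    refine maxminValue_le hM ?_
    rintro _ ⟨π, rfl⟩
    refine ⟨_, hW, ?_⟩
    have h1 := hregf π
    have h2 : ∑ t ∈ Finset.range T, M.features π ⬝ᵥ y t
        ≤ ∑ t ∈ Finset.range T, m t ⬝ᵥ w + (l + 4 * k * √T + 2 * k ^ 2 * √T)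
          + T * (4 * c) := by
      have : (T + 1 : ℝ) * (3 * c / 2) + (T + 1) * (c / 2) ≤ T * (4 * c) := by nlinarith
      linarith
    rw [hmix, dotProduct_sum]
    simp only [dotProduct_smul, smul_eq_mul]
    rw [← Finset.mul_sum]
    refine (mul_le_mul_of_nonneg_left h2 (by positivity)).trans (le_of_eq ?_)
    field_simp
  linarith

/-- For large `c` the guarantee is below the value of every policy. -/
lemma guarantee_of_le (hk : 0 < k) (hT : 0 < T) (hε : 0 < ε) (hck : 2 * (k : ℝ) ^ 2 * T ≤ c)
    (hM : ∀ μ ∈ M.featureSet, ∑ j, |μ j| ≤ k) (π : Fin T → Policy S A) {w : Fin k → ℝ}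
    (hw : w ∈ M.consistentWeights πE ε) :
    M.maxminValue πE ε - 4 * c ≤ M.mixtureFeatures π ⬝ᵥ w := by
  have hk1 : (1 : ℝ) ≤ k := by exact_mod_cast hk
  have hT1 : (1 : ℝ) ≤ T := by exact_mod_cast hT
  -- The zero weight is consistent, so the maxmin value is nonpositive, while every reward is at
  -- least `-k ≥ -4c`.
  have h1 : M.maxminValue πE ε ≤ 0 := maxminValue_le hM fun μ _ =>
    ⟨0, zero_mem_consistentWeights hε.le, by simp⟩
  have h2 : -(k : ℝ) ≤ M.mixtureFeatures π ⬝ᵥ w := by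
    rw [MDP.mixtureFeatures, smul_dotProduct, sum_dotProduct, smul_eq_mul]
    have h3 : ∑ _t : Fin T, -(k : ℝ) ≤ ∑ t, M.features (π t) ⬝ᵥ w :=
      Finset.sum_le_sum fun t _ => by
        simpa using (abs_le.1 (abs_features_dotProduct_le hM (π t) zero_le_one hw.1)).1
    have h4 := mul_le_mul_of_nonneg_left h3 (by positivity : (0 : ℝ) ≤ 1 / T)
    refine le_trans (le_of_eq ?_) h4
    simp
    field_simp
  have h5 : (k : ℝ) ≤ k ^ 2 * T := by nlinarith
  linarith

/-- With noise level `l = 4 k √T √(log (1/ξ))` the failure probability is at most `exp (-2 log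
(1/ξ))`, well below `2 ξ`. For `c ≥ 2 k² T`, where `η₂` is not a positive accuracy, the bound holds
surely. -/
lemma high_probability_guarantee (hk : 0 < k) (hT : 0 < T) (hε : 0 < ε) (hc : 0 < c)
    (hM : ∀ μ ∈ M.featureSet, ∑ j, |μ j| ≤ k) (halg : M.IsApproxSolver alg)
    (hmeas : ∀ η, 0 < η → Measurable fun w => M.features (alg w η)) {ξ : ℝ} (hξ : 0 < ξ)
    (hξ1 : ξ < 1 / 2) :
    ENNReal.ofReal (1 - 2 * ξ) ≤ ((perturbationLaw k T).prod (perturbationLaw k T))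
      {ω | ∀ w ∈ M.consistentWeights πE ε,
        M.maxminValue πE ε
            - (k : ℝ) ^ 2 * (6 + 4 * √(Real.log (1 / ξ))) / √T - 4 * c
          ≤ M.mixtureFeatures (policies M alg πE T ε c (ellipsoidIters k T ε c)
              (searchIters k T ε c) ω.1 ω.2) ⬝ᵥ w} := by
  have hk' : (0 : ℝ) < k := by exact_mod_cast hk
  have hk1 : (1 : ℝ) ≤ k := by exact_mod_cast hk
  have hT' : (0 : ℝ) < T := by exact_mod_cast hT
  have hs : 0 < √(T : ℝ) := Real.sqrt_pos.2 hT'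
  have hss : √(T : ℝ) * √T = T := Real.mul_self_sqrt hT'.le
  have hL : 0 < (k : ℝ) * √T := by positivity
  have := isProbabilityMeasure_cubeLaw k hL
  have hlog : 0 < Real.log (1 / ξ) := Real.log_pos (by rw [lt_div_iff₀ hξ]; linarith)
  set r := √(Real.log (1 / ξ)) with hr
  have hr0 : 0 ≤ r := Real.sqrt_nonneg _
  have hr2 : r ^ 2 = Real.log (1 / ξ) := Real.sq_sqrt hlog.le
  rw [perturbationLaw_eq]
  rcases lt_or_ge c (2 * (k : ℝ) ^ 2 * T) with hck | hck
  · have hconc := gameNoise_concentration (T := T) (cubeLaw k (k * √T))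
      (measurable_featurePlay hT hc hmeas)
      (measurable_weightPlay (πE := πE) hε hc hck hmeas (ellipsoidIters k T ε c)
        (searchIters k T ε c)) hk'
      (fun x y => abs_featurePlay_dotProduct_le hM x
        (weightPlay_spec (πE := πE) hk hT hε hc hck hM halg y).1.1) hT
      (l := 4 * k * √T * r) (by positivity)
    -- The event in question is only shown to contain the low-noise event, so its own measurability
    -- is not required.
    refine le_trans ?_ (hconc.trans (measure_mono fun ω hω w hw => ?_))
    · rw [ENNReal.ofReal_sub _ (by positivity), ENNReal.ofReal_one]
      apply tsub_le_tsub_left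
      apply ENNReal.ofReal_le_ofReal
      have e : (4 * k * √T * r) ^ 2 / (8 * (k : ℝ) ^ 2 * T) = 2 * Real.log (1 / ξ) := by
        rw [← hr2, mul_pow, mul_pow, sq (√(T : ℝ)), hss]; field_simp; ring
      have h1 : Real.exp (-Real.log (1 / ξ)) = ξ := by
        rw [one_div, Real.log_inv, neg_neg, Real.exp_log hξ]
      calc Real.exp (-((4 * k * √T * r) ^ 2 / (8 * (k : ℝ) ^ 2 * T)))
          ≤ Real.exp (-Real.log (1 / ξ)) := by
            rw [e]; exact Real.exp_le_exp.2 (by linarith)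
        _ = ξ := h1
        _ ≤ 2 * ξ := by linarith
    · refine le_trans ?_ (guarantee_of_noise_le hk hT hε hc hck hM halg hmeas hω hw)
      have e : (4 * k * √T * r + 4 * k * √T + 2 * k ^ 2 * √T) / T
          = (k * (4 + 4 * r) + 2 * k ^ 2) / √T := by
        rw [div_eq_div_iff hT'.ne' hs.ne']
        linear_combination (k * (4 + 4 * r) + 2 * (k : ℝ) ^ 2) * hss
      have h2 : (k * (4 + 4 * r) + 2 * (k : ℝ) ^ 2) / √T ≤ k ^ 2 * (6 + 4 * r) / √T := by
        apply div_le_div_of_nonneg_right _ hs.le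
        nlinarith [mul_le_mul_of_nonneg_right hk1 hk'.le]
      rw [e]
      linarith
  · have hall : {ω : (Fin T → Fin k → ℝ) × (Fin T → Fin k → ℝ) |
        ∀ w ∈ M.consistentWeights πE ε, M.maxminValue πE ε
            - (k : ℝ) ^ 2 * (6 + 4 * r) / √T - 4 * c
          ≤ M.mixtureFeatures (policies M alg πE T ε c (ellipsoidIters k T ε c)
              (searchIters k T ε c) ω.1 ω.2) ⬝ᵥ w} = Set.univ := by
      refine Set.eq_univ_of_forall fun ω w hw => ?_
      have h1 := guarantee_of_le hk hT hε hck hM (policies M alg πE T ε c (ellipsoidIters k T ε c)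
              (searchIters k T ε c) ω.1 ω.2) hw
      have h2 : 0 ≤ (k : ℝ) ^ 2 * (6 + 4 * r) / √T := by positivity
      linarith
    rw [hall, measure_univ]
    exact ENNReal.ofReal_le_one.2 (by linarith)

end Guarantee

end MaxminFPL

/-! ### The main theorem -/

open MaxminFPL
theorem mainTheorem5 :
    ∃ (C d : ℕ) (N J : ℕ → ℕ → ℝ → ℝ → ℕ),
      ∀ (k T : ℕ) (ε c : ℝ), 0 < k → 0 < T → 0 < ε → 0 < c →
        ((N k T ε c * J k T ε c : ℕ) : ℝ) ≤
          C * (k * (1 + Real.log T + Real.log (1 + 1 / ε) + Real.log (1 + 1 / c))) ^ d ∧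
        ∀ (S : Type*) (A : Type*) [Fintype S] (M : MDP S A k) (πE : Policy S A)
          (alg : (Fin k → ℝ) → ℝ → Policy S A),
          (∀ μ ∈ M.featureSet, ∑ j, |μ j| ≤ k) →
          M.IsApproxSolver alg →
          (∀ η, 0 < η → Measurable fun w => M.features (alg w η)) →
          (∀ (p q : Fin T → Fin k → ℝ) (t : Fin T),
            (roundAt M alg πE T ε c (N k T ε c) (J k T ε c) p q t).algQueries alg M.features
                (M.wso alg πE ε (eta₂ k T ε c)) = 1 ∧
            (((roundAt M alg πE T ε c (N k T ε c) (J k T ε c) p q t).wsoQueries alg M.features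
                (M.wso alg πE ε (eta₂ k T ε c)) : ℕ) : ℝ) ≤
              C * (k * (1 + Real.log T + Real.log (1 + 1 / ε) + Real.log (1 + 1 / c))) ^ d) ∧
          ∀ ξ : ℝ, 0 < ξ → ξ < 1 / 2 →
            ENNReal.ofReal (1 - 2 * ξ) ≤
              ((perturbationLaw k T).prod (perturbationLaw k T))
                {ω | ∀ w ∈ M.consistentWeights πE ε,
                  M.maxminValue πE ε
                      - (k : ℝ) ^ 2 * (6 + 4 * Real.sqrt (Real.log (1 / ξ))) / Real.sqrt T - 4 * c
                    ≤ M.mixtureFeatures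
                        (policies M alg πE T ε c (N k T ε c) (J k T ε c) ω.1 ω.2) ⬝ᵥ w} := by
  -- `15376 = 31² · 2⁴`: two factors 31 from the iteration numbers, and `⌈m⌉ ≤ 2m` to the fourth
  -- power.
  refine ⟨15376, 4, ellipsoidIters, searchIters, fun k T ε c hk hT hε hc =>
    ⟨iters_mul_le hk hε hc, ?_⟩⟩
  intro S A _ M πE alg hM halg hmeas
  refine ⟨fun p q t => ⟨roundProg_algQueries .., ?_⟩, fun ξ hξ hξ1 =>
    high_probability_guarantee hk hT hε hc hM halg hmeas hξ hξ1⟩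
  refine le_trans ?_ (iters_mul_le hk hε hc)
  exact_mod_cast roundProg_wsoQueries_le ..
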